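/- **Setting.** A single-lane ring road has $m\ge 1$ on-ramps and $m$ off-ramps, placed alternately, off-ramp $i$ coming after on-ramp $i$ and before on-ramp $i+1$ (indices modulo $m$); link $i$ is the section from on-ramp $i$ to off-ramp $i$. Vehicles have length $L$ and free flow speed $V_f$; the safety distance of a vehicle of speed $v_e$ behind one of speed $v_l$ is $S(v_e,v_l)=hv_e+S_0+\frac{v_e^2-v_l^2}{2|a_{\min}|}$. Time is divided into steps of length $\tau=h+(S_0+L)/V_f$. The mainline carries $n_c$ slots at mutual distance $\tau V_f$, which move at speed $V_f$, one position per step. A vehicle released from rest at the meter of on-ramp $i$ follows a fixed speed profile until it reaches $V_f$; it merges at a fixed merging point, and after $n_i$ steps (the time needed to leave the acceleration lane, rounded up) it occupies a mainline slot, in which it stays until it exits at its destination off-ramp. Let $\tau_i$ be the least multiple of $\tau$ such that a vehicle from on-ramp $i$ can safely merge, on a slot, between two slot-aligned vehicles at speed $V_f$ whose time headway is $\tau_i$, i.e. such that between merging and leaving the acceleration lane it is at a safe distance behind the first one and the second one is at a safe distance behind it. **Demand.** In each step a vehicle with destination off-ramp $j$ arrives at on-ramp $i$ with probability $\lambda_iR_{ij}$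 (at most one vehicle per on-ramp and step), independently over steps and on-ramps, where $\lambda_i\in[0,1]$, $R_{ij}\ge 0$, $\sum_jR_{ij}=1$. Let $\tilde R_{ij}$ be the fraction of arrivals at on-ramp $i$ that use link $j$, and let $\rho_j=\sum_i\lambda_i\tilde R_{ij}$. Arriving vehicles wait in a first-in-first-out queue at the ramp meter, of size $Q_i(t)$ at step $t$. **Renewal policy.** No vehicle is released until the vehicles initially on the road have reached the free flow state, which happens after some finite time. From then on the policy works in cycles. At the start of a cycle each on-ramp receives a quota equal to its queue size. In each step on-ramp $i$ releases one vehicle if it has not reached its quota, at least one step has passed since its last release, and the released vehicle would, between merging and leaving the acceleration lane, be at a safe distance from all vehicles on the road that are to cross its merging point (safe distance behind those in front of it, and vice versa for those behind it). A new cycle starts only once the quotas of the current cycle have cleared. (The theorem holds both if "cleared" means that all quotas have been released from the on-ramps and if it means that, moreover, all these vehicles have left the freeway.) **Theorem.** For every initial condition (initial queues, time at which free flow is reached, and positions of the initial vehicles at that time), the Renewal policy keeps the freeway under-saturated, i.e. $\limsup_{t\to\infty}\mathbb E[Q_i(t)]<\infty$ for all $i$, if $$\Big(\frac{\tau_i}{\tau}-1\Big)\rho_i-\Big(\frac{\tau_i}{\tau}-2\Big)\lambda_i<1\qquad\text{for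 all } i\in\{1,\dots,m\}.$$ Moreover, for every routing matrix $R$ the set of arrival rates given by this condition contains the corresponding inner estimate $\{\lambda:\ (\tau_i/\tau-1)\rho_i<1\ \text{for all } i\}$ for the Dynamic Release Rate (DRR) policy. -/

import Mathlib

noncomputable section

namespace RampMetering

/-- Common vehicle data: safe time headway constant `h`, standstill gap `S0`, vehicle length `L`,
free flow speed `Vf`, and minimum (most negative) deceleration `amin`. -/
structure VehicleParams where
  h : ℝ
  S0 : ℝ
  L : ℝ
  Vf : ℝ
  amin : ℝ
  h_pos : 0 < h
  S0_pos : 0 < S0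
  L_pos : 0 < L
  Vf_pos : 0 < Vf
  amin_neg : amin < 0

/-- Minimum safe time headway between front bumpers at free flow speed; the length of a time step. -/
def VehicleParams.tau (V : VehicleParams) : ℝ := V.h + (V.S0 + V.L) / V.Vf

/-- Safety distance of a vehicle of speed `ve` behind a leading vehicle of speed `vl`. -/
def VehicleParams.safetyDist (V : VehicleParams) (ve vl : ℝ) : ℝ :=
  V.h * ve + V.S0 + (ve ^ 2 - vl ^ 2) / (2 * |V.amin|)

/-- An on-ramp, described by the trajectory of a vehicle that is released from rest at the ramp
meter and stays in the speed tracking mode: `s` seconds after its release the vehicle is at distance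
`pos s` from the meter and has speed `speed s`. It crosses the merging point at time `tMerge`
(with merging speed `speed tMerge`), and leaves the acceleration lane at time `tFree`,
from which time on its speed is the free flow speed. -/
structure OnRamp (V : VehicleParams) where
  pos : ℝ → ℝ
  speed : ℝ → ℝ
  tMerge : ℝ
  tFree : ℝ
  pos_zero : pos 0 = 0
  speed_zero : speed 0 = 0
  hasDeriv : ∀ s, 0 ≤ s → HasDerivWithinAt pos (speed s) (Set.Ici 0) s
  speed_nonneg : ∀ s, 0 ≤ s → 0 ≤ speed s
  speed_le : ∀ s, 0 ≤ s → speed s ≤ V.Vf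
  tMerge_nonneg : 0 ≤ tMerge
  tMerge_le : tMerge ≤ tFree
  speed_free : ∀ s, tFree ≤ s → speed s = V.Vf

namespace OnRamp

variable {V : VehicleParams}

/-- Number of slots of the acceleration lane. -/
def numSlots (A : OnRamp V) : ℕ := ⌈A.tFree / V.tau⌉₊

/-- The released vehicle occupies a free-flow mainline slot from time `numSlots * tau` on. Followed
backwards in time at speed `Vf`, this slot is behind the vehicle by `drift s` at time `s`. -/
def drift (A : OnRamp V) (s : ℝ) : ℝ :=
  A.pos s + V.Vf * (A.numSlots * V.tau - s) - A.pos (A.numSlots * V.tau)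

/-- Between merging and leaving the acceleration lane, a vehicle released from this on-ramp is at a
safe distance behind a free-flow vehicle that travels `k` time steps ahead of its slot. -/
def SafeLeader (A : OnRamp V) (k : ℝ) : Prop :=
  ∀ s, A.tMerge ≤ s → s ≤ A.tFree →
    0 ≤ k * V.tau * V.Vf - A.drift s - V.L ∧
    V.safetyDist (A.speed s) V.Vf ≤ k * V.tau * V.Vf - A.drift s - V.L

/-- Between merging and leaving the acceleration lane of a vehicle released from this on-ramp,
a free-flow vehicle that travels `k` time steps behind its slot is at a safe distance behind it. -/
def SafeFollower (A : OnRamp V) (k : ℝ) : Prop :=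
  ∀ s, A.tMerge ≤ s → s ≤ A.tFree →
    V.safetyDist V.Vf (A.speed s) ≤ k * V.tau * V.Vf + A.drift s - V.L

/-- `τ_i / τ`: the least number `H` of time steps such that a vehicle from this on-ramp can safely
merge, on a slot, between two slot-aligned free-flow vehicles whose time headway is `H` steps. -/
def headwaySteps (A : OnRamp V) : ℕ :=
  sInf {H : ℕ | ∃ k l : ℕ, k + l = H ∧ A.SafeLeader k ∧ A.SafeFollower l}

/-- `τ_i`, in seconds. -/
def tauMerge (A : OnRamp V) : ℝ := A.headwaySteps * V.tau

end OnRamp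

/-- A ring road with `m` on-ramps and `m` off-ramps and `nc` mainline slots, each of which moves
one position per time step. The last acceleration lane slot of on-ramp `i` coincides with mainline
position `mergeSlot i`; a vehicle leaves through off-ramp `j` when it reaches position `exitSlot j`
(positions are read modulo `nc`). On- and off-ramps alternate in the direction of travel. -/
structure Freeway (m : ℕ) where
  veh : VehicleParams
  ramp : Fin m → OnRamp veh
  nc : ℕ
  mergeSlot : Fin m → ℕ
  exitSlot : Fin m → ℕ
  merge_lt_exit : ∀ i, mergeSlot i < exitSlot i
  exit_le_merge : ∀ i j, i < j → exitSlot i ≤ mergeSlot j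
  exit_le_wrap : ∀ i j, exitSlot i ≤ mergeSlot j + nc

/-- Location of a vehicle: `acc i k` is slot `k` of the acceleration lane of on-ramp `i`
(reached `k` time steps after release; slot `0` is the meter itself), and `main p` is mainline
position `p`. -/
inductive Loc (m nc : ℕ) where
  | acc (i : Fin m) (k : ℕ)
  | main (p : ZMod nc)

/-- A vehicle in the free flow state. It trails its slot by `lag` time steps; vehicles released by
the ramp meters have `lag = 0`, vehicles that were on the road at the outset need not. -/
structure Vehicle (m nc : ℕ) where
  loc : Loc m nc
  dest : Fin m
  lag : ℝ

namespace Freeway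

variable {m : ℕ}

/-- Arrival of a vehicle at mainline position `p`: it exits there if this is its destination. -/
def arriveAt (F : Freeway m) (u : Vehicle m F.nc) (p : ZMod F.nc) : Option (Vehicle m F.nc) :=
  if p = (F.exitSlot u.dest : ZMod F.nc) then none
  else some { loc := Loc.main p, dest := u.dest, lag := u.lag }

/-- Movement of a vehicle during one time step (`none`: it has exited). -/
def advance (F : Freeway m) (u : Vehicle m F.nc) : Option (Vehicle m F.nc) :=
  match u.loc with
  | Loc.acc i k =>
      if k < (F.ramp i).numSlots then
        some { loc := Loc.acc i (k + 1), dest := u.dest, lag := u.lag }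
      else F.arriveAt u ((F.mergeSlot i : ZMod F.nc) + 1)
  | Loc.main p => F.arriveAt u (p + 1)

/-- Number of time steps until the slot of a vehicle reaches position `mergeSlot i`. -/
def stepsToMerge (F : Freeway m) (i : Fin m) (u : Vehicle m F.nc) : ℕ :=
  match u.loc with
  | Loc.acc j k =>
      ((F.ramp j).numSlots - k) + ((F.mergeSlot i : ZMod F.nc) - (F.mergeSlot j : ZMod F.nc)).val
  | Loc.main p => ((F.mergeSlot i : ZMod F.nc) - p).val

/-- Number of time steps until a vehicle exits. -/
def stepsToExit (F : Freeway m) (u : Vehicle m F.nc) : ℕ :=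
  match u.loc with
  | Loc.acc j k =>
      ((F.ramp j).numSlots - k) +
        (((F.exitSlot u.dest : ZMod F.nc) - (F.mergeSlot j : ZMod F.nc) - 1).val + 1)
  | Loc.main p => ((F.exitSlot u.dest : ZMod F.nc) - p - 1).val + 1

/-- A vehicle that is not on the acceleration lane of on-ramp `i` does not conflict with a vehicle
released now from on-ramp `i`: it exits before the merging point, or it will be at a safe distance
in front of it or behind it. -/
def NoConflict (F : Freeway m) (i : Fin m) (u : Vehicle m F.nc) : Prop :=
  F.stepsToMerge i u < F.stepsToExit u →
    (F.ramp i).SafeLeader ((F.ramp i).numSlots - (F.stepsToMerge i u + u.lag)) ∨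
    (F.ramp i).SafeFollower ((F.stepsToMerge i u + u.lag) - (F.ramp i).numSlots)

/-- The safety conditions for releasing a vehicle from on-ramp `i`, as far as vehicle `u` is
concerned: at least one time step has passed since the release of a vehicle ahead on the same
acceleration lane, and every other vehicle leaves a safe merging gap. -/
def ReleaseSafe (F : Freeway m) (i : Fin m) (u : Vehicle m F.nc) : Prop :=
  match u.loc with
  | Loc.acc j k => (j = i → 1 ≤ (k : ℝ) - u.lag) ∧ (j ≠ i → F.NoConflict i u)
  | Loc.main _ => F.NoConflict i u

end Freeway

/-- State of the network: the destinations of the vehicles queueing at each on-ramp in order of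
arrival, the part of each quota that is still to be released in the current cycle, the vehicles
released by the ramp meters that are still on the road, and the vehicles that were on the road at
the outset and are still there. -/
structure State (m nc : ℕ) where
  queue : Fin m → List (Fin m)
  quota : Fin m → ℕ
  road : List (Vehicle m nc)
  residual : List (Vehicle m nc)

/-- When a cycle ends: as soon as all quotas have been released onto the acceleration lanes, or as
soon as, moreover, all the vehicles so released have left the freeway. -/
inductive CycleEnd where
  | released
  | exited

/-- The current cycle is over. -/
def CycleOver {m nc : ℕ} (rule : CycleEnd) (S : State m nc) : Prop :=
  (∀ i, S.quota i = 0) ∧ (rule = CycleEnd.exited → S.road = [])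

/-- The vehicle, if any, that joins an on-ramp queue: a mark `(true, d)` is an arrival with
destination `d`, a mark `(false, _)` is no arrival. -/
def newArrival {m : ℕ} (x : Bool × Fin m) : List (Fin m) :=
  if x.1 = true then [x.2] else []

open Classical in
/-- Start of a new cycle, if the current one is over: the quotas become the queue sizes. -/
def renew {m nc : ℕ} (rule : CycleEnd) (S : State m nc) : State m nc :=
  if CycleOver rule S then
    { queue := S.queue, quota := fun i => (S.queue i).length, road := S.road,
      residual := S.residual }
  else S

namespace Freeway

variable {m : ℕ}

/-- On-ramp `i` releases a vehicle: it has not reached its quota and the release is safe. -/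
def Releases (F : Freeway m) (S : State m F.nc) (i : Fin m) : Prop :=
  0 < S.quota i ∧ ∀ u ∈ S.road ++ S.residual, F.ReleaseSafe i u

open Classical in
/-- The vehicles released in state `S`. -/
def releasedVehicles (F : Freeway m) (S : State m F.nc) : List (Vehicle m F.nc) :=
  (List.finRange m).flatMap fun i =>
    if F.Releases S i then
      ((S.queue i).take 1).map fun d => { loc := Loc.acc i 0, dest := d, lag := 0 }
    else []

open Classical in
/-- Releases from state `S`, followed by the movement of all vehicles during one time step and the
arrivals `x` in that time step. -/
def releaseAndMove (F : Freeway m) (S : State m F.nc) (x : Fin m → Bool × Fin m) :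
    State m F.nc where
  queue i := (if F.Releases S i then (S.queue i).tail else S.queue i) ++ newArrival (x i)
  quota i := if F.Releases S i then S.quota i - 1 else S.quota i
  road := (S.road ++ F.releasedVehicles S).filterMap F.advance
  residual := S.residual.filterMap F.advance

/-- One time step under the Renewal policy. -/
def renewalStep (F : Freeway m) (rule : CycleEnd) (S : State m F.nc)
    (x : Fin m → Bool × Fin m) : State m F.nc :=
  F.releaseAndMove (renew rule S) x

/-- The state of the network at time `t` under the Renewal policy, for the arrivals `x`. The initial
queues are `q0`; nothing is released before time `T0`, at which the vehicles initially on the road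
have reached the free flow state, in the configuration `res0`; the first cycle starts at `T0`. -/
def renewalState (F : Freeway m) (rule : CycleEnd) (T0 : ℕ) (q0 : Fin m → List (Fin m))
    (res0 : List (Vehicle m F.nc)) (x : ℕ → Fin m → Bool × Fin m) : ℕ → State m F.nc
  | 0 => { queue := q0, quota := fun _ => 0, road := [], residual := res0 }
  | t + 1 =>
      let S := F.renewalState rule T0 q0 res0 x t
      if t < T0 then
        { queue := fun i => S.queue i ++ newArrival (x t i), quota := S.quota, road := S.road,
          residual := S.residual }
      else F.renewalStep rule S (x t)

end Freeway

/-- Vehicles from on-ramp `i` to off-ramp `d` use link `j`, the section from on-ramp `j` to off-ramp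
`j` (subtraction is modulo `m`). -/
def UsesLink {m : ℕ} (i d j : Fin m) : Prop := (j - i).val ≤ (d - i).val

open Classical in
/-- Cumulative routing matrix: the fraction of arrivals at on-ramp `i` that use link `j`. -/
def cumRouting {m : ℕ} (R : Matrix (Fin m) (Fin m) ℝ) (i j : Fin m) : ℝ :=
  ∑ d, if UsesLink i d j then R i d else 0

/-- Load `ρ_j` induced on link `j` by all the on-ramps. -/
def load {m : ℕ} (lam : Fin m → ℝ) (R : Matrix (Fin m) (Fin m) ℝ) (j : Fin m) : ℝ :=
  ∑ i, lam i * cumRouting R i j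

/-- Arrival rates: each one is a probability. -/
def IsRate {m : ℕ} (lam : Fin m → ℝ) : Prop := ∀ i, 0 ≤ lam i ∧ lam i ≤ 1

/-- Routing matrix: each row is a probability vector. -/
def IsRouting {m : ℕ} (R : Matrix (Fin m) (Fin m) ℝ) : Prop :=
  (∀ i j, 0 ≤ R i j) ∧ ∀ i, ∑ j, R i j = 1

open MeasureTheory ProbabilityTheory in
/-- The demand process: independently over time steps `t` and on-ramps `i`, a vehicle with
destination `d` arrives at on-ramp `i` in time step `t` with probability `λ_i R_{id}`. -/
structure IsDemand {m : ℕ} {Ω : Type*} [MeasurableSpace Ω] (P : Measure Ω) (lam : Fin m → ℝ)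
    (R : Matrix (Fin m) (Fin m) ℝ) (X : ℕ → Fin m → Ω → Bool × Fin m) : Prop where
  measurable : ∀ t i, Measurable (X t i)
  indep : iIndepFun (fun p : ℕ × Fin m => X p.1 p.2) P
  law : ∀ t i d, P {ω | X t i ω = (true, d)} = ENNReal.ofReal (lam i * R i d)

open MeasureTheory Filter in
/-- Under-saturation: `limsup_t E[Q_i(t)] < ∞` for every on-ramp, where `Q i t` is the size of the
queue at on-ramp `i` at time `t`. -/
def UnderSaturated {m : ℕ} {Ω : Type*} [MeasurableSpace Ω] (P : Measure Ω)
    (Q : Fin m → ℕ → Ω → ℕ) : Prop :=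
  ∀ i, limsup (fun t => ∫⁻ ω, (Q i t ω : ENNReal) ∂P) atTop < ⊤

/-- Inner estimate of the under-saturation region for the Renewal policy. -/
def renewalEstimate {m : ℕ} (F : Freeway m) (R : Matrix (Fin m) (Fin m) ℝ) : Set (Fin m → ℝ) :=
  {lam | IsRate lam ∧ ∀ i,
    ((F.ramp i).tauMerge / F.veh.tau - 1) * load lam R i
      - ((F.ramp i).tauMerge / F.veh.tau - 2) * lam i < 1}

/-- Inner estimate of the under-saturation region for the Dynamic Release Rate policy. -/
def drrEstimate {m : ℕ} (F : Freeway m) (R : Matrix (Fin m) (Fin m) ℝ) : Set (Fin m → ℝ) :=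
  {lam | IsRate lam ∧ ∀ i, ((F.ramp i).tauMerge / F.veh.tau - 1) * load lam R i < 1}

end RampMetering

end

/-! ### Kinematics: safe gaps at a merge and the merging headway. -/

noncomputable section

namespace RampMetering

namespace VehicleParams

/-! Write `H i` for `headwaySteps` of on-ramp `i`. The policy is analysed by a work count at each
on-ramp separately. A slot-aligned vehicle is harmless to a release at `i` if it is at least `k`
slots ahead or `l` slots behind, for some `k + l = H i`; hence it blocks `i` in at most `H i - 1`
steps (`exists_conflict_window`, `blockedTime_le_window`), and only if it comes from another on-ramp
and uses link `i`. A vehicle released at `i` itself costs just the step of its release. Charge these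
costs as weights to the waiting vehicles. In every step in which `i` has quota left, either it
releases or some vehicle blocks it, so the work still owed at `i` drops by at least one
(`quotaWork_add_roadWork_lt`). A cycle therefore lasts at most the largest work, over all on-ramps,
of its quotas, plus a constant.

The mean work arriving at `i` per step is `(H i - 1) * (ρ i - λ i) + λ i`, which is the left side of
the hypothesis (`meanWork_eq`). As it is below 1, a long cycle is followed on average by a shorter
one. This is made quantitative by the function `∑ i, exp (α * remaining + θ * arrivedWork i)` with
`0 < α < θ`. Inside a cycle each term is multiplied by a factor of mean at most `β < 1`; at a
renewal, arrived work turns into remaining time, and the exponent `θ` is traded for the smaller `α`,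
which leaves at most `ε` times the old value plus a constant (`exists_lyapunov_step`). Expectations
thus satisfy `a (t + 1) ≤ (β + ε) * a t + K` and stay bounded, and the function dominates the
queues.

The comparison with the DRR estimate only needs `H i ≥ 2`: each of the two gaps is at least one
slot. -/

theorem tau_pos (V : VehicleParams) : 0 < V.tau :=
  add_pos V.h_pos (div_pos (add_pos V.S0_pos V.L_pos) V.Vf_pos)

theorem tau_mul_Vf (V : VehicleParams) : V.tau * V.Vf = V.h * V.Vf + V.S0 + V.L := by
  have := V.Vf_pos.ne'
  unfold tau
  field_simp
  ring

end VehicleParams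

namespace OnRamp

variable {V : VehicleParams}

theorem tFree_nonneg (A : OnRamp V) : 0 ≤ A.tFree := A.tMerge_nonneg.trans A.tMerge_le

theorem tFree_le_numSlots_mul (A : OnRamp V) : A.tFree ≤ A.numSlots * V.tau :=
  (div_le_iff₀ V.tau_pos).1 (Nat.le_ceil _)

theorem continuousOn_pos (A : OnRamp V) : ContinuousOn A.pos (Set.Ici 0) :=
  fun s hs => (A.hasDeriv s hs).continuousWithinAt

/-- From `tFree` on the vehicle moves at speed `Vf`, as does its slot, so it is already aligned with
the slot when it leaves the acceleration lane, before the rounded-up time `numSlots * tau`. -/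
theorem drift_tFree (A : OnRamp V) : A.drift A.tFree = 0 := by
  have hpos : ∀ x ∈ Set.Icc A.tFree (A.numSlots * V.tau), 0 ≤ x :=
    fun x hx => A.tFree_nonneg.trans hx.1
  have key := constant_of_has_deriv_right_zero
    (f := fun s => A.pos s - V.Vf * s) (a := A.tFree) (b := A.numSlots * V.tau)
    ((A.continuousOn_pos.mono hpos).sub (by fun_prop))
    (fun x hx => by
      have hx0 : 0 ≤ x := A.tFree_nonneg.trans hx.1
      have h1 := (A.hasDeriv x hx0).mono (Set.Ici_subset_Ici.2 hx0)
      have h2 := ((hasDerivAt_id x).const_mul V.Vf).hasDerivWithinAt (s := Set.Ici x)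
      have h3 := h1.sub h2
      rw [A.speed_free x hx.1, mul_one, sub_self] at h3
      exact h3)
    (A.numSlots * V.tau) ⟨A.tFree_le_numSlots_mul, le_rfl⟩
  unfold drift
  linarith

theorem drift_bounded (A : OnRamp V) : ∃ B, ∀ s, A.tMerge ≤ s → s ≤ A.tFree → |A.drift s| ≤ B := by
  have hc : ContinuousOn A.drift (Set.Icc A.tMerge A.tFree) := by
    have h1 : ContinuousOn A.pos (Set.Icc A.tMerge A.tFree) :=
      A.continuousOn_pos.mono fun x hx => A.tMerge_nonneg.trans hx.1
    unfold drift
    exact (h1.add (by fun_prop)).sub continuousOn_const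
  obtain ⟨B, hB⟩ := isCompact_Icc.exists_bound_of_continuousOn hc
  exact ⟨B, fun s h1 h2 => hB s ⟨h1, h2⟩⟩

theorem SafeLeader.mono {A : OnRamp V} {k k' : ℝ} (h : A.SafeLeader k) (hk : k ≤ k') :
    A.SafeLeader k' := by
  intro s h1 h2
  obtain ⟨h3, h4⟩ := h s h1 h2
  have : k * V.tau * V.Vf ≤ k' * V.tau * V.Vf :=
    mul_le_mul_of_nonneg_right (mul_le_mul_of_nonneg_right hk V.tau_pos.le) V.Vf_pos.le
  exact ⟨by linarith, by linarith⟩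

theorem SafeFollower.mono {A : OnRamp V} {k k' : ℝ} (h : A.SafeFollower k) (hk : k ≤ k') :
    A.SafeFollower k' := by
  intro s h1 h2
  have h3 := h s h1 h2
  have : k * V.tau * V.Vf ≤ k' * V.tau * V.Vf :=
    mul_le_mul_of_nonneg_right (mul_le_mul_of_nonneg_right hk V.tau_pos.le) V.Vf_pos.le
  linarith

/-- At equal speeds `Vf` the braking term vanishes, and safety distance plus vehicle length is
exactly one slot, `tau * Vf`. -/
theorem one_le_of_safe_gap {k : ℝ} (h : V.safetyDist V.Vf V.Vf ≤ k * V.tau * V.Vf - V.L) :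
    1 ≤ k := by
  have h1 : V.safetyDist V.Vf V.Vf = V.h * V.Vf + V.S0 := by simp [VehicleParams.safetyDist]
  have h2 := V.tau_mul_Vf
  have h3 : 0 < V.tau * V.Vf := mul_pos V.tau_pos V.Vf_pos
  by_contra hk
  push Not at hk
  nlinarith

theorem SafeLeader.one_le {A : OnRamp V} {k : ℝ} (h : A.SafeLeader k) : 1 ≤ k := by
  have := (h A.tFree A.tMerge_le le_rfl).2
  rw [A.speed_free _ le_rfl, A.drift_tFree] at this
  exact one_le_of_safe_gap (by linarith)

theorem SafeFollower.one_le {A : OnRamp V} {k : ℝ} (h : A.SafeFollower k) : 1 ≤ k := by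
  have := h A.tFree A.tMerge_le le_rfl
  rw [A.speed_free _ le_rfl, A.drift_tFree] at this
  exact one_le_of_safe_gap (by linarith)

theorem exists_nat_mul_tau_ge (V : VehicleParams) (C : ℝ) :
    ∃ k : ℕ, C ≤ (k : ℝ) * V.tau * V.Vf := by
  have h3 : 0 < V.tau * V.Vf := mul_pos V.tau_pos V.Vf_pos
  obtain ⟨k, hk⟩ := exists_nat_ge (C / (V.tau * V.Vf))
  exact ⟨k, by rw [mul_assoc]; exact (div_le_iff₀ h3).1 hk⟩

theorem safetyDist_le {ve vl : ℝ} (h1 : ve ≤ V.Vf) (h0 : 0 ≤ ve) :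
    V.safetyDist ve vl ≤ V.h * V.Vf + V.S0 + V.Vf ^ 2 / (2 * |V.amin|) := by
  unfold VehicleParams.safetyDist
  have ha : 0 ≤ 2 * |V.amin| := by positivity
  have := V.h_pos
  gcongr
  nlinarith [sq_nonneg vl]

/-- The drift is bounded by compactness and safety distances are bounded at speeds up to `Vf`, so a
large enough gap suffices. Together with the follower version this makes the set defining
`headwaySteps` nonempty, so that its infimum is attained. -/
theorem exists_safeLeader (A : OnRamp V) : ∃ k : ℕ, A.SafeLeader k := by
  obtain ⟨B, hB⟩ := A.drift_bounded
  obtain ⟨k, hk⟩ := exists_nat_mul_tau_ge V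
    (B + V.L + (V.h * V.Vf + V.S0 + V.Vf ^ 2 / (2 * |V.amin|)))
  refine ⟨k, fun s h1 h2 => ?_⟩
  have hs := A.tMerge_nonneg.trans h1
  have h3 := (abs_le.1 (hB s h1 h2)).2
  have h4 := safetyDist_le (vl := V.Vf) (A.speed_le s hs) (A.speed_nonneg s hs)
  have h5 : 0 ≤ V.h * V.Vf + V.S0 + V.Vf ^ 2 / (2 * |V.amin|) := by
    have := V.h_pos
    have := V.Vf_pos
    have := V.S0_pos
    positivity
  exact ⟨by linarith, by linarith⟩

theorem exists_safeFollower (A : OnRamp V) : ∃ k : ℕ, A.SafeFollower k := by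
  obtain ⟨B, hB⟩ := A.drift_bounded
  obtain ⟨k, hk⟩ := exists_nat_mul_tau_ge V
    (B + V.L + (V.h * V.Vf + V.S0 + V.Vf ^ 2 / (2 * |V.amin|)))
  refine ⟨k, fun s h1 h2 => ?_⟩
  have h3 := (abs_le.1 (hB s h1 h2)).1
  have h4 := safetyDist_le (V := V) (vl := A.speed s) le_rfl V.Vf_pos.le
  linarith

theorem exists_headway (A : OnRamp V) :
    ∃ k l : ℕ, k + l = A.headwaySteps ∧ 1 ≤ k ∧ 1 ≤ l ∧ A.SafeLeader k ∧ A.SafeFollower l := by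
  obtain ⟨k, hk⟩ := A.exists_safeLeader
  obtain ⟨l, hl⟩ := A.exists_safeFollower
  obtain ⟨k', l', h, hk', hl'⟩ := Nat.sInf_mem
    (s := {H : ℕ | ∃ k l : ℕ, k + l = H ∧ A.SafeLeader k ∧ A.SafeFollower l})
    ⟨k + l, k, l, rfl, hk, hl⟩
  exact ⟨k', l', h, by exact_mod_cast hk'.one_le, by exact_mod_cast hl'.one_le, hk', hl'⟩

theorem two_le_headwaySteps (A : OnRamp V) : 2 ≤ A.headwaySteps := by
  obtain ⟨k, l, h, hk, hl, -⟩ := A.exists_headway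
  omega

theorem tauMerge_div_tau (A : OnRamp V) : A.tauMerge / V.tau = A.headwaySteps := by
  unfold tauMerge
  exact mul_div_cancel_right₀ _ V.tau_pos.ne'

end OnRamp

end RampMetering

end

/-! ### Motion on the ring: steps to the exit and to a merging point. -/

noncomputable section

namespace RampMetering

theorem zmod_val_sub_one_add_one {n : ℕ} [NeZero n] {a : ZMod n} (ha : a ≠ 0) :
    (a - 1).val + 1 = a.val := by
  have h0 : a.val ≠ 0 := fun h => ha ((ZMod.val_eq_zero a).1 h)
  have h1 : ((a.val - 1 : ℕ) : ZMod n) = a - 1 := by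
    rw [Nat.cast_sub (by omega), ZMod.natCast_zmod_val, Nat.cast_one]
  have h2 := ZMod.val_lt a
  rw [← h1, ZMod.val_cast_of_lt (by omega)]
  omega

theorem zmod_val_zero_sub_one_add_one (n : ℕ) [NeZero n] : ((0 : ZMod n) - 1).val + 1 = n := by
  obtain ⟨k, rfl⟩ := Nat.exists_eq_succ_of_ne_zero (NeZero.ne n)
  rw [zero_sub, ZMod.val_neg_one]

namespace Freeway

variable {m : ℕ}

theorem nc_ne_zero [NeZero m] (F : Freeway m) : F.nc ≠ 0 := by
  intro h
  have h1 := F.merge_lt_exit 0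
  have h2 := F.exit_le_wrap 0 0
  omega

theorem stepsToExit_pos (F : Freeway m) (u : Vehicle m F.nc) : 0 < F.stepsToExit u := by
  unfold stepsToExit
  split <;> omega

/-- A bound on the time a vehicle spends on the road. -/
def maxSteps (F : Freeway m) : ℕ := (∑ i, (F.ramp i).numSlots) + F.nc

theorem stepsToExit_le [NeZero m] (F : Freeway m) (u : Vehicle m F.nc) :
    F.stepsToExit u ≤ F.maxSteps := by
  have : NeZero F.nc := ⟨F.nc_ne_zero⟩
  unfold stepsToExit maxSteps
  split
  · rename_i j k _
    have h1 := Finset.single_le_sum (f := fun i => (F.ramp i).numSlots)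
      (fun i _ => Nat.zero_le _) (Finset.mem_univ j)
    have h2 := ZMod.val_lt ((F.exitSlot u.dest : ZMod F.nc) - (F.mergeSlot j : ZMod F.nc) - 1)
    omega
  · rename_i p _
    have h2 := ZMod.val_lt ((F.exitSlot u.dest : ZMod F.nc) - p - 1)
    omega

theorem arriveAt_eq_some {F : Freeway m} {u v : Vehicle m F.nc} {p : ZMod F.nc}
    (h : F.arriveAt u p = some v) :
    p ≠ (F.exitSlot u.dest : ZMod F.nc) ∧ v = ⟨Loc.main p, u.dest, u.lag⟩ := by
  unfold arriveAt at h
  split at h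
  · cases h
  · rename_i hp
    exact ⟨hp, by simpa using h.symm⟩

theorem advance_lag {F : Freeway m} {u v : Vehicle m F.nc} (h : F.advance u = some v) :
    v.lag = u.lag := by
  unfold advance at h
  split at h
  · split at h
    · obtain rfl := by simpa using h
      rfl
    · obtain ⟨-, rfl⟩ := arriveAt_eq_some h
      rfl
  · obtain ⟨-, rfl⟩ := arriveAt_eq_some h
    rfl

theorem advance_loc_acc {F : Freeway m} {u v : Vehicle m F.nc} (h : F.advance u = some v)
    {i : Fin m} {k : ℕ} (hv : v.loc = Loc.acc i k) : ∃ k', u.loc = Loc.acc i k' ∧ k = k' + 1 := by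
  unfold advance at h
  split at h
  · split at h
    · obtain rfl := by simpa using h
      rename_i j k' hu _
      obtain ⟨rfl, rfl⟩ := by simpa using hv
      exact ⟨k', hu, rfl⟩
    · obtain ⟨-, rfl⟩ := arriveAt_eq_some h
      cases hv
  · obtain ⟨-, rfl⟩ := arriveAt_eq_some h
    cases hv

theorem stepsToExit_main_succ [NeZero m] (F : Freeway m) {p : ZMod F.nc} {d : Fin m}
    (hp : p + 1 ≠ (F.exitSlot d : ZMod F.nc)) :
    ((F.exitSlot d : ZMod F.nc) - (p + 1) - 1).val + 1 = ((F.exitSlot d : ZMod F.nc) - p - 1).val := by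
  have : NeZero F.nc := ⟨F.nc_ne_zero⟩
  have h : (F.exitSlot d : ZMod F.nc) - p - 1 ≠ 0 := by
    intro h
    apply hp
    linear_combination -h
  rw [← zmod_val_sub_one_add_one h]
  ring_nf

theorem stepsToExit_advance [NeZero m] {F : Freeway m} {u v : Vehicle m F.nc}
    (h : F.advance u = some v) : F.stepsToExit u = F.stepsToExit v + 1 := by
  rcases u with ⟨_ | _, d, lag⟩
  · rename_i j k
    simp only [advance] at h
    split at h
    · obtain rfl := by simpa using h
      simp only [stepsToExit]
      omega
    · obtain ⟨hp, rfl⟩ := arriveAt_eq_some h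
      have := F.stepsToExit_main_succ hp
      simp only [stepsToExit] at this ⊢
      omega
  · rename_i p
    simp only [advance] at h
    obtain ⟨hp, rfl⟩ := arriveAt_eq_some h
    have := F.stepsToExit_main_succ hp
    simp only [stepsToExit] at this ⊢
    omega

/-- Distances to a merging point count down to zero and then wrap around to `nc - 1`. After the wrap
the vehicle exits before it could return, since its exit is less than a full circle away; so it
meets each merging point at most once. -/
theorem main_steps_succ [NeZero m] (F : Freeway m) (i : Fin m) {p : ZMod F.nc} {d : Fin m}
    (hp : p + 1 ≠ (F.exitSlot d : ZMod F.nc)) :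
    (((F.mergeSlot i : ZMod F.nc) - p).val ≠ 0 →
      ((F.mergeSlot i : ZMod F.nc) - p).val = ((F.mergeSlot i : ZMod F.nc) - (p + 1)).val + 1) ∧
    (((F.mergeSlot i : ZMod F.nc) - p).val = 0 →
      ((F.exitSlot d : ZMod F.nc) - (p + 1) - 1).val + 1 ≤
        ((F.mergeSlot i : ZMod F.nc) - (p + 1)).val) := by
  have : NeZero F.nc := ⟨F.nc_ne_zero⟩
  have e : (F.mergeSlot i : ZMod F.nc) - (p + 1) = (F.mergeSlot i : ZMod F.nc) - p - 1 := by ring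
  rw [e]
  constructor
  · intro h
    rw [zmod_val_sub_one_add_one]
    intro h0
    exact h (by rw [h0, ZMod.val_zero])
  · intro h
    rw [(ZMod.val_eq_zero _).1 h, F.stepsToExit_main_succ hp]
    have h1 := zmod_val_zero_sub_one_add_one F.nc
    have h2 := ZMod.val_lt ((F.exitSlot d : ZMod F.nc) - p - 1)
    omega

theorem stepsToMerge_advance [NeZero m] {F : Freeway m} {u v : Vehicle m F.nc} (i : Fin m)
    (h : F.advance u = some v) :
    (F.stepsToMerge i u ≠ 0 → F.stepsToMerge i u = F.stepsToMerge i v + 1) ∧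
    (F.stepsToMerge i u = 0 → F.stepsToExit v ≤ F.stepsToMerge i v) := by
  rcases u with ⟨_ | _, d, lag⟩
  · rename_i j k
    simp only [advance] at h
    split at h
    · obtain rfl := by simpa using h
      simp only [stepsToMerge]
      omega
    · obtain ⟨hp, rfl⟩ := arriveAt_eq_some h
      have := F.main_steps_succ i hp
      have hk : (F.ramp j).numSlots - k = 0 := by omega
      simp only [stepsToMerge, stepsToExit, hk, Nat.zero_add] at this ⊢
      exact this
  · rename_i p
    simp only [advance] at h
    obtain ⟨hp, rfl⟩ := arriveAt_eq_some h
    simpa only [stepsToMerge, stepsToExit] using F.main_steps_succ i hp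

/-! ### Blocked time: how long a vehicle prevents releases at an on-ramp. -/

open Classical in
/-- The number of time steps among the next `n` in which vehicle `u` blocks on-ramp `i`. -/
def blockedSteps (F : Freeway m) (i : Fin m) : ℕ → Vehicle m F.nc → ℕ
  | 0, _ => 0
  | n + 1, u => (if F.ReleaseSafe i u then 0 else 1) + (F.advance u).elim 0 (F.blockedSteps i n)

/-- The number of time steps in which vehicle `u` blocks on-ramp `i` before it exits. -/
def blockedTime (F : Freeway m) (i : Fin m) (u : Vehicle m F.nc) : ℕ :=
  F.blockedSteps i (F.stepsToExit u) u

-- `stepsToExit` drops by exactly one per move, so it is the right amount of fuel for `blockedSteps`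
-- and the recursion closes up on `blockedTime`.
open Classical in
theorem blockedTime_eq [NeZero m] (F : Freeway m) (i : Fin m) (u : Vehicle m F.nc) :
    F.blockedTime i u =
      (if F.ReleaseSafe i u then 0 else 1) + (F.advance u).elim 0 (F.blockedTime i) := by
  obtain ⟨n, hn⟩ := Nat.exists_eq_succ_of_ne_zero (F.stepsToExit_pos u).ne'
  rw [blockedTime, hn, blockedSteps]
  rcases h : F.advance u with _ | v
  · rfl
  · have := stepsToExit_advance h
    have hv : F.stepsToExit v = n := by omega
    simp only [Option.elim, blockedTime, hv]

theorem blockedSteps_le (F : Freeway m) (i : Fin m) (n : ℕ) (u : Vehicle m F.nc) :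
    F.blockedSteps i n u ≤ n := by
  induction n generalizing u with
  | zero => simp [blockedSteps]
  | succ n ih =>
    rw [blockedSteps]
    rcases F.advance u with _ | v
    · simp only [Option.elim]
      split <;> omega
    · have := ih v
      simp only [Option.elim]
      split <;> omega

theorem blockedTime_le_maxSteps [NeZero m] (F : Freeway m) (i : Fin m) (u : Vehicle m F.nc) :
    F.blockedTime i u ≤ F.maxSteps :=
  (F.blockedSteps_le i _ u).trans (F.stepsToExit_le u)

/-- A slot-aligned vehicle conflicts with on-ramp `i` only while it is in a window of
`headwaySteps - 1` positions relative to the merging slot. -/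
theorem exists_conflict_window (F : Freeway m) (i : Fin m) :
    ∃ a b : ℕ, b - a ≤ (F.ramp i).headwaySteps - 1 ∧ ∀ u : Vehicle m F.nc, u.lag = 0 →
      ¬ F.NoConflict i u →
        a ≤ F.stepsToMerge i u ∧ F.stepsToMerge i u < b ∧ F.stepsToMerge i u < F.stepsToExit u := by
  obtain ⟨k, l, hkl, hk, hl, hlead, hfol⟩ := (F.ramp i).exists_headway
  -- With `n = numSlots`, a vehicle `s` steps from the merging slot is safe ahead if `s ≤ n - k` and
  -- safe behind if `s ≥ n + l`. In between lie `k + l - 1` integers, and truncation of `n + 1 - k`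
  -- at zero only shrinks the window.
  refine ⟨(F.ramp i).numSlots + 1 - k, (F.ramp i).numSlots + l, by omega, fun u hlag hu => ?_⟩
  unfold NoConflict at hu
  push Not at hu
  obtain ⟨h1, h2, h3⟩ := hu
  rw [hlag, add_zero] at h2 h3
  refine ⟨?_, ?_, h1⟩
  · by_contra hlt
    refine h2 (hlead.mono ?_)
    have : k + F.stepsToMerge i u ≤ (F.ramp i).numSlots := by omega
    have : (k : ℝ) + F.stepsToMerge i u ≤ (F.ramp i).numSlots := by exact_mod_cast this
    linarith
  · by_contra hlt
    refine h3 (hfol.mono ?_)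
    have : (F.ramp i).numSlots + l ≤ F.stepsToMerge i u := by omega
    have : ((F.ramp i).numSlots : ℝ) + l ≤ F.stepsToMerge i u := by exact_mod_cast this
    linarith

/-- Vehicles released by the meters, at least one time step after their release. -/
def Released (F : Freeway m) (u : Vehicle m F.nc) : Prop :=
  u.lag = 0 ∧ ∀ i k, u.loc = Loc.acc i k → 1 ≤ k

theorem Released.of_advance {F : Freeway m} {u v : Vehicle m F.nc} (hu : u.lag = 0)
    (h : F.advance u = some v) : F.Released v := by
  refine ⟨(advance_lag h).trans hu, fun i k hk => ?_⟩
  obtain ⟨k', -, rfl⟩ := advance_loc_acc h hk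
  omega

theorem not_noConflict_of_not_releaseSafe {F : Freeway m} {i : Fin m} {u : Vehicle m F.nc}
    (hlag : u.lag = 0) (hacc : ∀ k, u.loc = Loc.acc i k → 1 ≤ k) (hs : ¬ F.ReleaseSafe i u) :
    ¬ F.NoConflict i u := by
  intro hn
  apply hs
  rcases u with ⟨_ | _, d, lag⟩
  · rename_i j k
    refine ⟨?_, fun _ => hn⟩
    rintro rfl
    have := hacc k rfl
    simp only at hlag
    simp only [hlag, sub_zero]
    exact_mod_cast this
  · exact hn

/-- The bound counts the window positions `[a, b)` not beyond the current `stepsToMerge`. Each move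
uses up one position, and once the merging point is passed, or if the exit comes first, nothing
remains. -/
theorem blockedTime_le_window [NeZero m] (F : Freeway m) (i : Fin m) (a b : ℕ)
    (hab : ∀ u : Vehicle m F.nc, u.lag = 0 → ¬ F.NoConflict i u →
        a ≤ F.stepsToMerge i u ∧ F.stepsToMerge i u < b ∧ F.stepsToMerge i u < F.stepsToExit u)
    (n : ℕ) (u : Vehicle m F.nc) (hn : F.stepsToExit u ≤ n) (hlag : u.lag = 0)
    (hacc : ∀ k, u.loc = Loc.acc i k → 1 ≤ k) :
    F.blockedTime i u ≤
      if F.stepsToMerge i u < F.stepsToExit u then min (F.stepsToMerge i u + 1) b - a else 0 := by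
  induction n generalizing u with
  | zero => exact absurd (F.stepsToExit_pos u) (by omega)
  | succ n ih =>
    obtain ⟨c, hc, h1⟩ : ∃ c, F.blockedTime i u = c + (F.advance u).elim 0 (F.blockedTime i) ∧
        (c = 0 ∨ c = 1 ∧ a ≤ F.stepsToMerge i u ∧ F.stepsToMerge i u < b ∧
          F.stepsToMerge i u < F.stepsToExit u) := by
      refine ⟨_, F.blockedTime_eq i u, ?_⟩
      by_cases hs : F.ReleaseSafe i u
      · exact Or.inl (if_pos hs)
      · exact Or.inr ⟨if_neg hs, hab u hlag (not_noConflict_of_not_releaseSafe hlag hacc hs)⟩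
    rw [hc]
    rcases h : F.advance u with _ | v
    · simp only [Option.elim]
      split_ifs with h2 <;> omega
    · simp only [Option.elim]
      have h2 := stepsToExit_advance h
      obtain ⟨h3, h4⟩ := stepsToMerge_advance i h
      obtain ⟨h5, h6⟩ := Released.of_advance hlag h
      have h7 := ih v (by omega) h5 (h6 i)
      split_ifs at h7 ⊢ <;> omega

theorem blockedTime_of_stepsToExit_le [NeZero m] (F : Freeway m) (i : Fin m) (u : Vehicle m F.nc)
    (hlag : u.lag = 0) (hacc : ∀ k, u.loc = Loc.acc i k → 1 ≤ k)
    (h : F.stepsToExit u ≤ F.stepsToMerge i u) : F.blockedTime i u = 0 := by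
  obtain ⟨a, b, -, hab⟩ := F.exists_conflict_window i
  have := F.blockedTime_le_window i a b hab _ u le_rfl hlag hacc
  rw [if_neg (by omega)] at this
  omega

theorem blockedTime_own_lane [NeZero m] (F : Freeway m) (i : Fin m) (n : ℕ) (u : Vehicle m F.nc)
    (hn : F.stepsToExit u ≤ n) (hlag : u.lag = 0) {k : ℕ} (hk : 1 ≤ k)
    (hu : u.loc = Loc.acc i k) : F.blockedTime i u = 0 := by
  induction n generalizing u k with
  | zero => exact absurd (F.stepsToExit_pos u) (by omega)
  | succ n ih =>
    have hs : F.ReleaseSafe i u := by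
      unfold ReleaseSafe
      rw [hu]
      refine ⟨fun _ => ?_, fun h => absurd rfl h⟩
      rw [hlag, sub_zero]
      exact_mod_cast hk
    rw [blockedTime_eq, if_pos hs]
    rcases h : F.advance u with _ | v
    · rfl
    · simp only [Option.elim, zero_add]
      have h2 := stepsToExit_advance h
      have hR := Released.of_advance hlag h
      by_cases hkn : k < (F.ramp i).numSlots
      · have h' := h
        simp only [advance, hu, if_pos hkn, Option.some.injEq] at h'
        exact ih v (by omega) hR.1 (k := k + 1) (by omega) (by rw [← h'])
      · refine F.blockedTime_of_stepsToExit_le i v hR.1 (hR.2 i) ((stepsToMerge_advance i h).2 ?_)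
        simp only [stepsToMerge, hu, sub_self, ZMod.val_zero]
        omega

/-- On its own lane the vehicle is at least one slot ahead of the meter, and when it leaves the lane
it has passed its merging point for good. This is why own vehicles weigh 1 and not `headwaySteps -
1`. -/
theorem blockedTime_own_new [NeZero m] (F : Freeway m) (i d : Fin m) {v : Vehicle m F.nc}
    (h : F.advance ⟨Loc.acc i 0, d, 0⟩ = some v) : F.blockedTime i v = 0 := by
  have hR := Released.of_advance rfl h
  by_cases hkn : 0 < (F.ramp i).numSlots
  · have h' := h
    simp only [advance, if_pos hkn, Option.some.injEq] at h'
    exact F.blockedTime_own_lane i _ v le_rfl hR.1 (k := 1) le_rfl (by rw [← h'])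
  · refine F.blockedTime_of_stepsToExit_le i v hR.1 (hR.2 i) ((stepsToMerge_advance i h).2 ?_)
    simp only [stepsToMerge, sub_self, ZMod.val_zero]
    omega

theorem mergeSlot_mono (F : Freeway m) {i j : Fin m} (h : i ≤ j) :
    F.mergeSlot i ≤ F.mergeSlot j := by
  rcases h.eq_or_lt with rfl | h
  · exact le_rfl
  · exact (F.merge_lt_exit i).le.trans (F.exit_le_merge i j h)

theorem natCast_val_of_eq [NeZero m] (F : Freeway m) {x y e : ℕ} (he : e < F.nc)
    (h : x = y + e ∨ x + F.nc = y + e) : ((x : ZMod F.nc) - (y : ZMod F.nc)).val = e := by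
  have : NeZero F.nc := ⟨F.nc_ne_zero⟩
  have : (x : ZMod F.nc) - (y : ZMod F.nc) = (e : ZMod F.nc) := by
    rcases h with h | h
    · rw [h]; push_cast; ring
    · have := congrArg (Nat.cast : ℕ → ZMod F.nc) h
      push_cast at this
      rw [ZMod.natCast_self] at this
      linear_combination this
  rw [this, ZMod.val_cast_of_lt he]

theorem fin_sub_val [NeZero m] (a b : Fin m) :
    (b ≤ a → (a - b).val = a.val - b.val) ∧ (a < b → (a - b).val = a.val + m - b.val) := by
  refine ⟨fun h => Fin.sub_val_of_le h, fun h => ?_⟩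
  have h1 : a.val < b.val := h
  have h2 := b.isLt
  rw [Fin.val_sub, Nat.mod_eq_of_lt (by omega)]
  omega

/-- A vehicle on the acceleration lane of on-ramp `j` crosses the merging point of another on-ramp
only if it uses the corresponding link. -/
theorem usesLink_of_crosses [NeZero m] (F : Freeway m) {i j d : Fin m} (hij : j ≠ i)
    (h : ((F.mergeSlot i : ZMod F.nc) - (F.mergeSlot j : ZMod F.nc)).val <
      ((F.exitSlot d : ZMod F.nc) - (F.mergeSlot j : ZMod F.nc) - 1).val + 1) :
    UsesLink j d i := by
  by_contra hU
  unfold UsesLink at hU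
  push Not at hU
  have e1 : (F.exitSlot d : ZMod F.nc) - (F.mergeSlot j : ZMod F.nc) - 1 =
      (F.exitSlot d : ZMod F.nc) - ((F.mergeSlot j + 1 : ℕ) : ZMod F.nc) := by push_cast; ring
  rw [e1] at h
  have hi := F.merge_lt_exit i
  have hj := F.merge_lt_exit j
  have hd := F.merge_lt_exit d
  have w1 := F.exit_le_wrap i j
  have w2 := F.exit_le_wrap j i
  have w3 := F.exit_le_wrap j d
  have w4 := F.exit_le_wrap d j
  obtain ⟨s1, s2⟩ := fin_sub_val i j
  obtain ⟨s3, s4⟩ := fin_sub_val d j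
  have bi := i.isLt
  have bj := j.isLt
  have bd := d.isLt
  -- The cyclic order of `j`, `d`, `i` splits into cases according to which of `i` and `d` lie past
  -- the wrap seen from `j`; in each, the distances modulo `nc` become explicit natural numbers.
  rcases lt_or_gt_of_ne hij with hlt | hlt
  · have o1 := F.exit_le_merge j i hlt
    rw [s1 hlt.le] at hU
    rw [F.natCast_val_of_eq (e := F.mergeSlot i - F.mergeSlot j) (by omega) (by omega)] at h
    rcases le_or_gt j d with hd' | hd'
    · rw [s3 hd'] at hU
      have o2 := F.exit_le_merge d i (by simp only [Fin.lt_def, Fin.le_def] at *; omega)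
      have o3 := F.mergeSlot_mono hd'
      rw [F.natCast_val_of_eq (e := F.exitSlot d - (F.mergeSlot j + 1)) (by omega) (by omega)] at h
      omega
    · rw [s4 hd'] at hU
      omega
  · have o1 := F.exit_le_merge i j hlt
    rw [s2 hlt] at hU
    rw [F.natCast_val_of_eq (e := F.mergeSlot i + F.nc - F.mergeSlot j) (by omega) (by omega)] at h
    rcases le_or_gt j d with hd' | hd'
    · rw [s3 hd'] at hU
      have o3 := F.mergeSlot_mono hd'
      have w5 := F.exit_le_wrap d i
      rw [F.natCast_val_of_eq (e := F.exitSlot d - (F.mergeSlot j + 1)) (by omega) (by omega)] at h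
      omega
    · rw [s4 hd'] at hU
      have o2 := F.exit_le_merge d i (by simp only [Fin.lt_def] at *; omega)
      rw [F.natCast_val_of_eq (e := F.exitSlot d + F.nc - (F.mergeSlot j + 1)) (by omega)
        (by omega)] at h
      omega

open Classical in
/-- The number of time steps that a vehicle from on-ramp `j` to off-ramp `d` takes up at
on-ramp `i`: one step for a release there, `headwaySteps - 1` steps for a passing vehicle. -/
def weight (F : Freeway m) (i j d : Fin m) : ℕ :=
  if j = i then 1 else if UsesLink j d i then (F.ramp i).headwaySteps - 1 else 0

/-- The window length bounds the blocked time of a vehicle crossing merging point `i`, and crossing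
it forces the use of link `i`. -/
theorem blockedTime_new_le [NeZero m] (F : Freeway m) {i j : Fin m} (d : Fin m) (hij : j ≠ i)
    {v : Vehicle m F.nc} (h : F.advance ⟨Loc.acc j 0, d, 0⟩ = some v) :
    F.blockedTime i v ≤ F.weight i j d := by
  classical
  obtain ⟨a, b, hlen, hab⟩ := F.exists_conflict_window i
  have h1 := F.blockedTime_le_window i a b hab _ ⟨Loc.acc j 0, d, 0⟩ le_rfl rfl (by
    intro k hk
    simp only [Loc.acc.injEq] at hk
    exact absurd hk.1 hij)
  rw [blockedTime_eq, h] at h1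
  simp only [Option.elim] at h1
  rw [weight, if_neg hij]
  by_cases hc : F.stepsToMerge i ⟨Loc.acc j 0, d, 0⟩ < F.stepsToExit ⟨Loc.acc j 0, d, 0⟩
  · have hU : UsesLink j d i := by
      apply F.usesLink_of_crosses hij
      simp only [stepsToMerge, stepsToExit] at hc
      omega
    rw [if_pos hc] at h1
    rw [if_pos hU]
    omega
  · rw [if_neg hc] at h1
    omega

end Freeway

end RampMetering

end

/-! ### Work accounting and the length of a cycle. -/

noncomputable section

namespace RampMetering

theorem sum_map_filterMap {α β : Type*} (l : List α) (g : α → Option β) (f : β → ℕ) :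
    ((l.filterMap g).map f).sum = (l.map fun u => (g u).elim 0 f).sum := by
  induction l with
  | nil => rfl
  | cons u l ih =>
    rcases h : g u with _ | v
    · simp [h, ih]
    · simp [h, ih]

namespace Freeway

variable {m : ℕ}

/-- Total weight at on-ramp `i` of the vehicles in the lists `q`. -/
def queueWork (F : Freeway m) (i : Fin m) (q : Fin m → List (Fin m)) : ℕ :=
  ∑ j, ((q j).map (F.weight i j)).sum

/-- Weight at on-ramp `i` of the vehicles still to be released in the current cycle. -/
def quotaWork (F : Freeway m) (i : Fin m) (S : State m F.nc) : ℕ :=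
  F.queueWork i fun j => (S.queue j).take (S.quota j)

/-- Weight at on-ramp `i` of the vehicles that have arrived in the current cycle. -/
def arrivedWork (F : Freeway m) (i : Fin m) (S : State m F.nc) : ℕ :=
  F.queueWork i fun j => (S.queue j).drop (S.quota j)

/-- Weight at on-ramp `i` of the arrivals `x` in one time step. -/
def arrivalWork (F : Freeway m) (i : Fin m) (x : Fin m → Bool × Fin m) : ℕ :=
  F.queueWork i fun j => newArrival (x j)

/-- Number of time steps in which the vehicles on the road block on-ramp `i`, with multiplicity. -/
def roadWork (F : Freeway m) (i : Fin m) (S : State m F.nc) : ℕ :=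
  ((S.road ++ S.residual).map (F.blockedTime i)).sum

/-- An upper bound on the remaining length of the current cycle. -/
def remaining (F : Freeway m) (S : State m F.nc) : ℕ :=
  (Finset.univ.sup fun i =>
    if 0 < S.quota i then F.quotaWork i S + F.roadWork i S + F.maxSteps else 0) ⊔
    ((S.road.map F.stepsToExit : List ℕ) : Multiset ℕ).sup

theorem remaining_le_iff (F : Freeway m) (S : State m F.nc) (n : ℕ) :
    F.remaining S ≤ n ↔
      (∀ i, 0 < S.quota i → F.quotaWork i S + F.roadWork i S + F.maxSteps ≤ n) ∧
      ∀ u ∈ S.road, F.stepsToExit u ≤ n := by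
  unfold remaining
  rw [sup_le_iff, Finset.sup_le_iff, Multiset.sup_le]
  refine and_congr ⟨fun h i hi => ?_, fun h i _ => ?_⟩ ?_
  · simpa [hi] using h i (Finset.mem_univ i)
  · split
    · exact h i ‹_›
    · exact Nat.zero_le _
  · simp

/-- The facts about the state of the network that hold at all times. -/
structure Admissible (F : Freeway m) (N : ℕ) (S : State m F.nc) : Prop where
  quota_le : ∀ i, S.quota i ≤ (S.queue i).length
  road_count : ∀ k, (S.road.map fun u => if k ≤ F.stepsToExit u then 1 else 0).sum ≤
    m * (F.maxSteps - k)
  residual_length : S.residual.length ≤ N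

theorem Admissible.renew {F : Freeway m} {N : ℕ} {S : State m F.nc} (h : F.Admissible N S)
    (rule : CycleEnd) : F.Admissible N (renew rule S) := by
  unfold RampMetering.renew
  split
  · exact ⟨fun i => le_rfl, h.road_count, h.residual_length⟩
  · exact h

open Classical in
theorem sum_map_releasedVehicles (F : Freeway m) (S : State m F.nc) (f : Vehicle m F.nc → ℕ) :
    ((F.releasedVehicles S).map f).sum =
      ∑ j, (((if F.Releases S j then ((S.queue j).take 1) else []).map
        fun d => f ⟨Loc.acc j 0, d, 0⟩).sum) := by
  rw [Fin.sum_univ_def]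
  unfold releasedVehicles
  induction List.finRange m with
  | nil => simp
  | cons j l ih =>
    rw [List.flatMap_cons, List.map_append, List.sum_append, ih, List.map_cons, List.sum_cons]
    congr 1
    split
    · simp [List.map_map, Function.comp_def]
    · simp

theorem length_releasedVehicles_le (F : Freeway m) (S : State m F.nc) :
    (F.releasedVehicles S).length ≤ m := by
  classical
  have h := F.sum_map_releasedVehicles S fun _ => 1
  simp only [List.map_const', List.sum_replicate, smul_eq_mul, mul_one] at h
  rw [h]
  calc _ ≤ ∑ j : Fin m, 1 := by
        refine Finset.sum_le_sum fun j _ => ?_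
        split
        · exact List.length_take_le 1 _
        · simp
    _ = m := by simp

/-- What becomes of the queue and the quota of an on-ramp in one time step. -/
theorem queue_releaseAndMove (F : Freeway m) (S : State m F.nc) (x : Fin m → Bool × Fin m)
    (j : Fin m) (hq : S.quota j ≤ (S.queue j).length) :
    (∃ d l q, F.Releases S j ∧ S.queue j = d :: l ∧ S.quota j = q + 1 ∧ q ≤ l.length ∧
      (F.releaseAndMove S x).queue j = l ++ newArrival (x j) ∧
      (F.releaseAndMove S x).quota j = q) ∨
    (¬ F.Releases S j ∧ (F.releaseAndMove S x).queue j = S.queue j ++ newArrival (x j) ∧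
      (F.releaseAndMove S x).quota j = S.quota j) := by
  by_cases h : F.Releases S j
  · left
    have h0 := h.1
    rcases hl : S.queue j with _ | ⟨d, l⟩
    · rw [hl] at hq
      simp only [List.length_nil] at hq
      omega
    · rw [hl, List.length_cons] at hq
      refine ⟨d, l, S.quota j - 1, h, rfl, by omega, by omega, ?_, ?_⟩
      · simp [releaseAndMove, h, hl]
      · simp [releaseAndMove, h]
  · right
    exact ⟨h, by simp [releaseAndMove, h], by simp [releaseAndMove, h]⟩

theorem Admissible.quota_le_releaseAndMove {F : Freeway m} {N : ℕ} {S : State m F.nc}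
    (h : F.Admissible N S) (x : Fin m → Bool × Fin m) (j : Fin m) :
    (F.releaseAndMove S x).quota j ≤ ((F.releaseAndMove S x).queue j).length := by
  have hq := h.quota_le j
  rcases F.queue_releaseAndMove S x j hq with ⟨d, l, q, -, h1, h2, h3, h4, h5⟩ | ⟨-, h4, h5⟩
  · rw [h4, h5, List.length_append]; omega
  · rw [h4, h5, List.length_append]; omega

/-- Queues are first-in-first-out: releases shorten the front part, of length `quota`, while
arrivals join the part behind it. -/
theorem arrivedWork_releaseAndMove {F : Freeway m} {N : ℕ} {S : State m F.nc}
    (h : F.Admissible N S) (x : Fin m → Bool × Fin m) (i : Fin m) :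
    F.arrivedWork i (F.releaseAndMove S x) = F.arrivedWork i S + F.arrivalWork i x := by
  unfold arrivedWork arrivalWork queueWork
  rw [← Finset.sum_add_distrib]
  refine Finset.sum_congr rfl fun j _ => ?_
  beta_reduce
  have hq := h.quota_le j
  rcases F.queue_releaseAndMove S x j hq with ⟨d, l, q, -, h1, h2, h3, h4, h5⟩ | ⟨-, h4, h5⟩
  · rw [h4, h5, h1, h2, List.drop_append_of_le_length h3]
    simp
  · rw [h4, h5, List.drop_append_of_le_length hq]
    simp

/-- For `road_count`, vehicles with at least `k` steps left had at least `k + 1` before the move,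
and at most `m` new ones appear. The count graded by `k` is what makes the induction close. -/
theorem Admissible.releaseAndMove [NeZero m] {F : Freeway m} {N : ℕ} {S : State m F.nc}
    (h : F.Admissible N S) (x : Fin m → Bool × Fin m) :
    F.Admissible N (F.releaseAndMove S x) := by
  refine ⟨h.quota_le_releaseAndMove x, fun k => ?_,
    (List.length_filterMap_le _ _).trans h.residual_length⟩
  simp only [Freeway.releaseAndMove]
  rw [sum_map_filterMap]
  have key : ∀ u : Vehicle m F.nc,
      ((F.advance u).elim 0 fun u => if k ≤ F.stepsToExit u then 1 else 0) ≤
        if k + 1 ≤ F.stepsToExit u then 1 else 0 := by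
    intro u
    rcases hu : F.advance u with _ | v
    · simp
    · have := stepsToExit_advance hu
      simp only [Option.elim]
      split_ifs <;> omega
  rcases lt_or_ge k F.maxSteps with hk | hk
  · rw [List.map_append, List.sum_append]
    have h1 : (S.road.map fun u => (F.advance u).elim 0 fun u =>
        if k ≤ F.stepsToExit u then 1 else 0).sum ≤ m * (F.maxSteps - (k + 1)) :=
      (List.sum_le_sum fun u _ => key u).trans (h.road_count (k + 1))
    have h2 : ((F.releasedVehicles S).map fun u => (F.advance u).elim 0 fun u =>
        if k ≤ F.stepsToExit u then 1 else 0).sum ≤ m := by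
      refine (List.sum_le_card_nsmul _ 1 ?_).trans ?_
      · intro y hy
        obtain ⟨u, -, rfl⟩ := List.mem_map.1 hy
        refine (key u).trans ?_
        split <;> omega
      · simpa using F.length_releasedVehicles_le S
    obtain ⟨c, hc⟩ := Nat.exists_eq_add_of_lt hk
    have e1 : F.maxSteps - (k + 1) = c := by omega
    have e2 : F.maxSteps - k = c + 1 := by omega
    rw [e1] at h1
    rw [e2, Nat.mul_succ]
    omega
  · have : ∀ u : Vehicle m F.nc,
        ((F.advance u).elim 0 fun u => if k ≤ F.stepsToExit u then 1 else 0) = 0 := by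
      intro u
      have h1 := key u
      have h2 := F.stepsToExit_le u
      rw [if_neg (by omega)] at h1
      omega
    simp only [this]
    simp

-- Weight leaving the quotas pays for the future blocked time of the released vehicles. The strict
-- decrease comes from on-ramp `i` itself: its release has weight 1 and causes no blocking there,
-- and if it does not release, a blocking vehicle uses up one of its blocked steps.
open Classical in
theorem quotaWork_add_roadWork_lt [NeZero m] {F : Freeway m} {N : ℕ} {S : State m F.nc}
    (h : F.Admissible N S) (x : Fin m → Bool × Fin m) (i : Fin m) (hi : 0 < S.quota i) :
    F.quotaWork i (F.releaseAndMove S x) + F.roadWork i (F.releaseAndMove S x) <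
      F.quotaWork i S + F.roadWork i S := by
  set G : Vehicle m F.nc → ℕ := fun u => (F.advance u).elim 0 (F.blockedTime i) with hG
  have hblk : ∀ u, F.blockedTime i u = (if F.ReleaseSafe i u then 0 else 1) + G u :=
    F.blockedTime_eq i
  have hroad : F.roadWork i (F.releaseAndMove S x) =
      ((S.road ++ S.residual).map G).sum + ((F.releasedVehicles S).map G).sum := by
    unfold roadWork
    simp only [Freeway.releaseAndMove, List.map_append, List.sum_append, sum_map_filterMap,
      ← hG]
    omega
  -- The balance at each on-ramp `j`: remaining quota, plus blocked time created by the release,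
  -- plus a surplus of 1 when `i` itself releases.
  have hnew : ∀ j, ((((F.releaseAndMove S x).queue j).take ((F.releaseAndMove S x).quota j)).map
        (F.weight i j)).sum +
      ((if F.Releases S j then ((S.queue j).take 1) else []).map
        fun d => G ⟨Loc.acc j 0, d, 0⟩).sum +
      (if j = i ∧ F.Releases S i then 1 else 0) ≤
      (((S.queue j).take (S.quota j)).map (F.weight i j)).sum := by
    intro j
    have hq := h.quota_le j
    rcases F.queue_releaseAndMove S x j hq with ⟨d, l, q, hr, h1, h2, h3, h4, h5⟩ | ⟨hr, h4, h5⟩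
    · rw [h4, h5, h1, h2, List.take_append_of_le_length h3, if_pos hr]
      simp only [List.take_succ_cons, List.take_zero, List.map_cons, List.map_nil, List.sum_cons,
        List.sum_nil]
      by_cases hji : j = i
      · subst hji
        have : G ⟨Loc.acc j 0, d, 0⟩ = 0 := by
          simp only [hG]
          rcases hv : F.advance ⟨Loc.acc j 0, d, 0⟩ with _ | v
          · rfl
          · exact F.blockedTime_own_new j d hv
        rw [this, if_pos ⟨rfl, hr⟩, weight, if_pos rfl]
        omega
      · have : G ⟨Loc.acc j 0, d, 0⟩ ≤ F.weight i j d := by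
          simp only [hG]
          rcases hv : F.advance ⟨Loc.acc j 0, d, 0⟩ with _ | v
          · exact Nat.zero_le _
          · exact F.blockedTime_new_le d hji hv
        rw [if_neg (fun hc => hji hc.1)]
        omega
    · rw [h4, h5, List.take_append_of_le_length hq, if_neg hr, if_neg]
      · simp
      · rintro ⟨rfl, h'⟩
        exact hr h'
  have hsum := Finset.sum_le_sum fun j (_ : j ∈ Finset.univ) => hnew j
  rw [Finset.sum_add_distrib, Finset.sum_add_distrib, ← F.sum_map_releasedVehicles S G] at hsum
  have hroad' : ((S.road ++ S.residual).map G).sum ≤ F.roadWork i S := by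
    refine List.sum_le_sum fun u _ => ?_
    rw [hblk u]
    omega
  rw [hroad]
  unfold quotaWork queueWork
  beta_reduce
  by_cases hr : F.Releases S i
  · have h1 : ∑ j, (if j = i ∧ F.Releases S i then 1 else 0) = 1 := by simp [hr]
    omega
  · have h1 : ((S.road ++ S.residual).map G).sum < F.roadWork i S := by
      unfold Releases at hr
      push Not at hr
      obtain ⟨u, hu, hsafe⟩ := hr hi
      refine List.sum_lt_sum _ _ (fun u _ => ?_) ⟨u, hu, ?_⟩
      · rw [hblk u]
        omega
      · rw [hblk u, if_neg hsafe]
        omega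
    omega

/-- The summand `maxSteps` in `remaining` reserves time for the last released vehicles to exit, so a
release never raises the bound and both rules for the end of a cycle are covered. -/
theorem remaining_releaseAndMove_le [NeZero m] {F : Freeway m} {N : ℕ} {S : State m F.nc}
    (h : F.Admissible N S) (x : Fin m → Bool × Fin m) :
    F.remaining (F.releaseAndMove S x) ≤ F.remaining S - 1 := by
  classical
  obtain ⟨h1, h2⟩ := (F.remaining_le_iff S _).1 le_rfl
  refine (F.remaining_le_iff _ _).2 ⟨fun i hi => ?_, fun v hv => ?_⟩
  · have hi' : 0 < S.quota i := by
      rcases F.queue_releaseAndMove S x i (h.quota_le i) with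
        ⟨d, l, q, -, -, h2, -, -, -⟩ | ⟨-, -, h5⟩ <;> omega
    have h3 := F.quotaWork_add_roadWork_lt h x i hi'
    have h4 := h1 i hi'
    omega
  · simp only [Freeway.releaseAndMove, List.mem_filterMap, List.mem_append] at hv
    obtain ⟨u, hu, huv⟩ := hv
    have h3 := stepsToExit_advance huv
    rcases hu with hu | hu
    · have := h2 u hu
      omega
    · simp only [releasedVehicles, List.mem_flatMap] at hu
      obtain ⟨i, -, hu⟩ := hu
      split at hu
      · rename_i hr
        have h4 := h1 i hr.1
        have h5 := F.stepsToExit_le u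
        omega
      · cases hu

theorem maxSteps_pos [NeZero m] (F : Freeway m) : 0 < F.maxSteps :=
  Nat.add_pos_right _ (Nat.pos_of_ne_zero F.nc_ne_zero)

theorem remaining_pos_of_not_cycleOver [NeZero m] (F : Freeway m) {S : State m F.nc}
    {rule : CycleEnd} (h : ¬ CycleOver rule S) : 0 < F.remaining S := by
  obtain ⟨h1, h2⟩ := (F.remaining_le_iff S _).1 le_rfl
  unfold CycleOver at h
  by_cases hq : ∀ i, S.quota i = 0
  · have hroad : S.road ≠ [] := fun h' => h ⟨hq, fun _ => h'⟩
    obtain ⟨u, hu⟩ := List.exists_mem_of_ne_nil _ hroad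
    exact (F.stepsToExit_pos u).trans_le (h2 u hu)
  · push Not at hq
    obtain ⟨i, hi⟩ := hq
    have h3 := h1 i (Nat.pos_of_ne_zero hi)
    have h4 := F.maxSteps_pos
    omega

theorem arrivedWork_renew (F : Freeway m) {S : State m F.nc} {rule : CycleEnd}
    (h : CycleOver rule S) (i : Fin m) : F.arrivedWork i (renew rule S) = 0 := by
  simp [renew, h, arrivedWork, queueWork]

/-- The part of the length of a cycle that is due to the vehicles on the road at its start. -/
def overhead (F : Freeway m) (N : ℕ) : ℕ := (m * F.maxSteps + N) * F.maxSteps + F.maxSteps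

theorem Admissible.length_road_le {F : Freeway m} {N : ℕ} {S : State m F.nc}
    (h : F.Admissible N S) : S.road.length ≤ m * F.maxSteps := by
  simpa using h.road_count 0

/-- At a renewal all old quotas are zero, so the whole queue is arrived work and becomes the new
quota work. The number of vehicles on the road is bounded, and each blocks for at most `maxSteps`
steps, whatever its lag. -/
theorem exists_remaining_renew_le [NeZero m] {F : Freeway m} {N : ℕ} {S : State m F.nc}
    (hS : F.Admissible N S) {rule : CycleEnd} (h : CycleOver rule S) :
    ∃ i, F.remaining (renew rule S) ≤ F.arrivedWork i S + F.overhead N := by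
  obtain ⟨i, -, hi⟩ := Finset.exists_max_image Finset.univ (fun i => F.arrivedWork i S)
    ⟨0, Finset.mem_univ _⟩
  refine ⟨i, (F.remaining_le_iff _ _).2 ⟨fun j _ => ?_, fun u _ => ?_⟩⟩
  · have h1 : F.quotaWork j (renew rule S) = F.arrivedWork j S := by
      simp [renew, h, arrivedWork, quotaWork, h.1]
    have h2 : F.roadWork j (renew rule S) ≤ (m * F.maxSteps + N) * F.maxSteps := by
      have h3 : F.roadWork j (renew rule S) = ((S.road ++ S.residual).map (F.blockedTime j)).sum := by
        simp [renew, h, roadWork]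
      rw [h3]
      refine (List.sum_le_card_nsmul _ F.maxSteps ?_).trans ?_
      · intro y hy
        obtain ⟨u, -, rfl⟩ := List.mem_map.1 hy
        exact F.blockedTime_le_maxSteps j u
      · rw [List.length_map, List.length_append, smul_eq_mul]
        exact Nat.mul_le_mul_right _ (Nat.add_le_add hS.length_road_le hS.residual_length)
    have h4 := hi j (Finset.mem_univ j)
    unfold overhead
    omega
  · have := F.stepsToExit_le u
    unfold overhead
    omega

/-- Own vehicles have weight 1, so the work at an on-ramp dominates its queue. -/
theorem length_le_queueWork (F : Freeway m) (i : Fin m) (q : Fin m → List (Fin m)) :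
    (q i).length ≤ F.queueWork i q := by
  have h1 : ((q i).map (F.weight i i)).sum = (q i).length := by
    have : F.weight i i = fun _ => 1 := by
      funext d
      simp [weight]
    simp [this]
  rw [← h1]
  exact Finset.single_le_sum (f := fun j => ((q j).map (F.weight i j)).sum)
    (fun _ _ => Nat.zero_le _) (Finset.mem_univ i)

theorem Admissible.length_queue_le {F : Freeway m} {N : ℕ} {S : State m F.nc}
    (h : F.Admissible N S) (i : Fin m) :
    (S.queue i).length ≤ F.remaining S + F.arrivedWork i S := by
  have h1 := F.length_le_queueWork i fun j => (S.queue j).take (S.quota j)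
  have h2 := F.length_le_queueWork i fun j => (S.queue j).drop (S.quota j)
  have h3 := ((F.remaining_le_iff S _).1 le_rfl).1 i
  have h4 := h.quota_le i
  simp only [List.length_take, List.length_drop] at h1 h2
  unfold quotaWork at h3
  unfold arrivedWork
  by_cases hq : 0 < S.quota i
  · have := h3 hq
    omega
  · omega

theorem admissible_renewalState [NeZero m] (F : Freeway m) (rule : CycleEnd) (T0 : ℕ)
    (q0 : Fin m → List (Fin m)) (res0 : List (Vehicle m F.nc)) (x : ℕ → Fin m → Bool × Fin m)
    (t : ℕ) : F.Admissible res0.length (F.renewalState rule T0 q0 res0 x t) := by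
  induction t with
  | zero => exact ⟨fun _ => Nat.zero_le _, fun _ => by simp [renewalState], le_rfl⟩
  | succ t ih =>
    rw [renewalState]
    split
    · refine ⟨fun i => ?_, ih.road_count, ih.residual_length⟩
      have := ih.quota_le i
      simp only [List.length_append]
      omega
    · exact (ih.renew rule).releaseAndMove _

theorem renewalState_congr (F : Freeway m) (rule : CycleEnd) (T0 : ℕ)
    (q0 : Fin m → List (Fin m)) (res0 : List (Vehicle m F.nc)) {x y : ℕ → Fin m → Bool × Fin m}
    (t : ℕ) (h : ∀ s < t, x s = y s) :
    F.renewalState rule T0 q0 res0 x t = F.renewalState rule T0 q0 res0 y t := by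
  induction t with
  | zero => rfl
  | succ t ih =>
    rw [renewalState, renewalState, ih fun s hs => h s (by omega), h t (by omega)]

/-- The dichotomy on which the stability of the Renewal policy rests: within a cycle, the bound on
its remaining length decreases; at the start of a cycle, it is set by the arrivals during the
previous one. -/
theorem renewalStep_dichotomy [NeZero m] {F : Freeway m} {N : ℕ} {S : State m F.nc}
    (hS : F.Admissible N S) (rule : CycleEnd) (x : Fin m → Bool × Fin m) :
    (F.remaining (F.renewalStep rule S x) + 1 ≤ F.remaining S ∧
      ∀ i, F.arrivedWork i (F.renewalStep rule S x) = F.arrivedWork i S + F.arrivalWork i x) ∨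
    ((∃ i, F.remaining (F.renewalStep rule S x) ≤ F.arrivedWork i S + F.overhead N) ∧
      ∀ i, F.arrivedWork i (F.renewalStep rule S x) = F.arrivalWork i x) := by
  have hR := hS.renew rule
  have h1 := remaining_releaseAndMove_le hR x
  have h2 := arrivedWork_releaseAndMove hR x
  unfold renewalStep
  by_cases h : CycleOver rule S
  · right
    obtain ⟨i, hi⟩ := exists_remaining_renew_le hS h
    refine ⟨⟨i, by omega⟩, fun i => ?_⟩
    rw [h2, F.arrivedWork_renew h, zero_add]
  · left
    have h3 : renew rule S = S := by simp [renew, h]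
    have h4 := F.remaining_pos_of_not_cycleOver h
    rw [h3] at h1 h2 ⊢
    exact ⟨by omega, h2⟩

end Freeway

end RampMetering

end

/-! ### The Lyapunov function and the mean arriving work. -/

noncomputable section

namespace RampMetering

open MeasureTheory ProbabilityTheory Filter

namespace Freeway

variable {m : ℕ}

theorem arrivalWork_eq_sum (F : Freeway m) (i : Fin m) (x : Fin m → Bool × Fin m) :
    F.arrivalWork i x = ∑ j, ∑ d, if x j = (true, d) then F.weight i j d else 0 := by
  unfold arrivalWork queueWork
  refine Finset.sum_congr rfl fun j _ => ?_
  rcases h : x j with ⟨b, d⟩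
  cases b <;> simp [newArrival, h]

/-- A bound on the weight of the arrivals in one time step. -/
def maxArrivalWork (F : Freeway m) : ℕ := ∑ i, ∑ j, ∑ d, F.weight i j d

theorem arrivalWork_le (F : Freeway m) (i : Fin m) (x : Fin m → Bool × Fin m) :
    F.arrivalWork i x ≤ F.maxArrivalWork := by
  rw [arrivalWork_eq_sum]
  refine le_trans ?_ (Finset.single_le_sum (f := fun i => ∑ j, ∑ d, F.weight i j d)
    (fun _ _ => Nat.zero_le _) (Finset.mem_univ i))
  refine Finset.sum_le_sum fun j _ => Finset.sum_le_sum fun d _ => ?_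
  split <;> omega

/-- An exponential Lyapunov function for the Renewal policy. -/
def lyapunov (F : Freeway m) (α θ : ℝ) (S : State m F.nc) : ℝ :=
  ∑ i, Real.exp (α * F.remaining S + θ * F.arrivedWork i S)

theorem exp_le_lyapunov (F : Freeway m) (α θ : ℝ) (S : State m F.nc) (i : Fin m) :
    Real.exp (α * F.remaining S + θ * F.arrivedWork i S) ≤ F.lyapunov α θ S :=
  Finset.single_le_sum (f := fun i => Real.exp (α * F.remaining S + θ * F.arrivedWork i S))
    (fun _ _ => (Real.exp_pos _).le) (Finset.mem_univ i)

theorem lyapunov_nonneg (F : Freeway m) (α θ : ℝ) (S : State m F.nc) : 0 ≤ F.lyapunov α θ S :=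
  Finset.sum_nonneg fun _ _ => (Real.exp_pos _).le

theorem exists_mul_exp_le {α θ ε c : ℝ} (hα : 0 ≤ α) (hαθ : α < θ) (hε : 0 < ε) (hc : 0 ≤ c) :
    ∃ K, 0 ≤ K ∧ ∀ a : ℝ, c * Real.exp (α * a) ≤ ε * Real.exp (θ * a) + K := by
  have hd : 0 < θ - α := sub_pos.2 hαθ
  -- Beyond the threshold `a = c / ε / (θ - α)`, `exp ((θ - α) * a)` exceeds `c / ε`; below it the
  -- left side is at most this constant.
  refine ⟨c * Real.exp (α * (c / ε / (θ - α))), by positivity, fun a => ?_⟩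
  rcases le_total a (c / ε / (θ - α)) with h | h
  · have h1 : c * Real.exp (α * a) ≤ c * Real.exp (α * (c / ε / (θ - α))) := by gcongr
    have h2 : 0 ≤ ε * Real.exp (θ * a) := by positivity
    linarith
  · have h1 : c ≤ ε * Real.exp ((θ - α) * a) := by
      rw [div_le_iff₀ hd, div_le_iff₀ hε] at h
      have h2 := Real.add_one_le_exp ((θ - α) * a)
      nlinarith
    have h3 : c * Real.exp (α * a) ≤ ε * Real.exp (θ * a) := by
      calc _ ≤ ε * Real.exp ((θ - α) * a) * Real.exp (α * a) := by gcongr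
        _ = _ := by rw [mul_assoc, ← Real.exp_add]; ring_nf
    have h4 : 0 ≤ c * Real.exp (α * (c / ε / (θ - α))) := by positivity
    linarith

/-- The first summand covers steps inside a cycle. At a renewal the new value is at most a constant
times `exp (α * arrivedWork i₀)`, which `exists_mul_exp_le` absorbs into `ε` times the old value
plus `K`. -/
theorem exists_lyapunov_step [NeZero m] (F : Freeway m) (N : ℕ) {α θ ε : ℝ} (hα : 0 ≤ α)
    (hαθ : α < θ) (hε : 0 < ε) :
    ∃ K, 0 ≤ K ∧ ∀ (rule : CycleEnd) (S : State m F.nc) (x : Fin m → Bool × Fin m),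
      F.Admissible N S → F.lyapunov α θ (F.renewalStep rule S x) ≤
        (∑ i, Real.exp (α * F.remaining S + θ * F.arrivedWork i S) *
          Real.exp (θ * F.arrivalWork i x - α)) + ε * F.lyapunov α θ S + K := by
  have hθ : 0 < θ := hα.trans_lt hαθ
  obtain ⟨K, hK0, hK⟩ := exists_mul_exp_le (α := α) (θ := θ) (ε := ε)
    (c := m * Real.exp (α * F.overhead N + θ * F.maxArrivalWork)) hα hαθ hε (by positivity)
  refine ⟨K, hK0, fun rule S x hS => ?_⟩
  have hL := F.lyapunov_nonneg α θ S
  rcases renewalStep_dichotomy hS rule x with ⟨h1, h2⟩ | ⟨⟨i₀, h1⟩, h2⟩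
  · have h3 : F.lyapunov α θ (F.renewalStep rule S x) ≤
        ∑ i, Real.exp (α * F.remaining S + θ * F.arrivedWork i S) *
          Real.exp (θ * F.arrivalWork i x - α) := by
      refine Finset.sum_le_sum fun i _ => ?_
      rw [← Real.exp_add, h2 i]
      refine Real.exp_le_exp.2 ?_
      have h4 : (F.remaining (F.renewalStep rule S x) : ℝ) + 1 ≤ F.remaining S := by
        exact_mod_cast h1
      push_cast
      nlinarith
    have h4 : 0 ≤ ε * F.lyapunov α θ S := by positivity
    linarith
  · have h3 : F.lyapunov α θ (F.renewalStep rule S x) ≤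
        m * Real.exp (α * F.overhead N + θ * F.maxArrivalWork) *
          Real.exp (α * F.arrivedWork i₀ S) := by
      calc F.lyapunov α θ (F.renewalStep rule S x)
          ≤ ∑ _i : Fin m, Real.exp (α * F.overhead N + θ * F.maxArrivalWork) *
              Real.exp (α * F.arrivedWork i₀ S) := by
            refine Finset.sum_le_sum fun i _ => ?_
            rw [← Real.exp_add, h2 i]
            refine Real.exp_le_exp.2 ?_
            have h4 : (F.remaining (F.renewalStep rule S x) : ℝ) ≤
                F.arrivedWork i₀ S + F.overhead N := by exact_mod_cast h1
            have h5 : (F.arrivalWork i x : ℝ) ≤ F.maxArrivalWork := by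
              exact_mod_cast F.arrivalWork_le i x
            have h6 := mul_le_mul_of_nonneg_left h4 hα
            have h7 := mul_le_mul_of_nonneg_left h5 hθ.le
            linarith
        _ = _ := by simp [mul_assoc]
    have h4 : Real.exp (θ * F.arrivedWork i₀ S) ≤ F.lyapunov α θ S := by
      refine le_trans (Real.exp_le_exp.2 ?_) (F.exp_le_lyapunov α θ S i₀)
      have : 0 ≤ α * F.remaining S := by positivity
      linarith
    have h5 : 0 ≤ ∑ i, Real.exp (α * F.remaining S + θ * F.arrivedWork i S) *
          Real.exp (θ * F.arrivalWork i x - α) := Finset.sum_nonneg fun _ _ => by positivity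
    have h6 := hK (F.arrivedWork i₀ S)
    have h7 := mul_le_mul_of_nonneg_left h4 hε.le
    linarith

theorem Admissible.length_queue_le_lyapunov {F : Freeway m} {N : ℕ} {S : State m F.nc}
    (h : F.Admissible N S) {α θ : ℝ} (hα : 0 < α) (hαθ : α < θ) (i : Fin m) :
    ((S.queue i).length : ℝ) ≤ α⁻¹ * F.lyapunov α θ S := by
  rw [← div_eq_inv_mul, le_div_iff₀ hα]
  have h1 : ((S.queue i).length : ℝ) ≤ F.remaining S + F.arrivedWork i S := by
    exact_mod_cast h.length_queue_le i
  have h2 := F.exp_le_lyapunov α θ S i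
  have h3 := Real.add_one_le_exp (α * F.remaining S + θ * F.arrivedWork i S)
  have h4 : α * (F.arrivedWork i S : ℝ) ≤ θ * F.arrivedWork i S := by gcongr
  nlinarith

/-- Mean weight at on-ramp `i` of the arrivals in one time step. -/
def meanWork (F : Freeway m) (lam : Fin m → ℝ) (R : Matrix (Fin m) (Fin m) ℝ) (i : Fin m) : ℝ :=
  ∑ j, ∑ d, F.weight i j d * (lam j * R j d)

/-- Every vehicle from on-ramp `i` uses link `i`; weighing it 1 instead of `headwaySteps - 1` yields
the discount `(headwaySteps - 2) * lam i`. -/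
theorem meanWork_eq [NeZero m] (F : Freeway m) (lam : Fin m → ℝ) {R : Matrix (Fin m) (Fin m) ℝ}
    (hR : IsRouting R) (i : Fin m) :
    F.meanWork lam R i = ((F.ramp i).tauMerge / F.veh.tau - 1) * load lam R i
      - ((F.ramp i).tauMerge / F.veh.tau - 2) * lam i := by
  classical
  have hH := (F.ramp i).two_le_headwaySteps
  rw [OnRamp.tauMerge_div_tau, load, Finset.mul_sum]
  have : ((F.ramp i).headwaySteps - 2 : ℝ) * lam i =
      ∑ j, if j = i then ((F.ramp i).headwaySteps - 2 : ℝ) * lam i else 0 := by simp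
  rw [this, ← Finset.sum_sub_distrib]
  refine Finset.sum_congr rfl fun j _ => ?_
  by_cases hj : j = i
  · subst hj
    have h1 : cumRouting R j j = 1 := by
      rw [← hR.2 j]
      refine Finset.sum_congr rfl fun d _ => if_pos ?_
      unfold UsesLink
      rw [sub_self]
      exact Nat.zero_le _
    simp only [weight, if_true, h1, Nat.cast_one, one_mul, ← Finset.mul_sum, hR.2 j]
    ring
  · simp only [weight, if_neg hj, sub_zero, cumRouting, Finset.mul_sum]
    refine Finset.sum_congr rfl fun d _ => ?_
    split_ifs
    · rw [Nat.cast_sub (by omega)]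
      push_cast
      ring
    · simp

theorem lintegral_arrivalWork (F : Freeway m) {lam : Fin m → ℝ} {R : Matrix (Fin m) (Fin m) ℝ}
    (hlam : IsRate lam) (hR : IsRouting R) {Ω : Type*} [MeasurableSpace Ω] {P : Measure Ω}
    {X : ℕ → Fin m → Ω → Bool × Fin m} (hX : IsDemand P lam R X) (t : ℕ) (i : Fin m) :
    ∫⁻ ω, (F.arrivalWork i fun j => X t j ω : ENNReal) ∂P = ENNReal.ofReal (F.meanWork lam R i) := by
  classical
  have hset : ∀ j d, MeasurableSet {ω | X t j ω = (true, d)} := fun j d =>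
    hX.measurable t j (measurableSet_singleton _)
  have hterm : ∀ j d ω, ((if X t j ω = (true, d) then F.weight i j d else 0 : ℕ) : ENNReal) =
      {ω | X t j ω = (true, d)}.indicator (fun _ => (F.weight i j d : ENNReal)) ω := by
    intro j d ω
    simp only [Set.indicator_apply, Set.mem_ofPred_eq]
    split_ifs <;> simp
  simp only [arrivalWork_eq_sum, Nat.cast_sum, hterm]
  have hnn : ∀ j d, 0 ≤ lam j * R j d := fun j d => mul_nonneg (hlam j).1 (hR.1 j d)
  rw [lintegral_finsetSum _ fun j _ => Finset.measurable_fun_sum _ fun d _ =>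
    measurable_const.indicator (hset j d), meanWork,
    ENNReal.ofReal_sum_of_nonneg fun j _ => Finset.sum_nonneg fun d _ =>
      mul_nonneg (Nat.cast_nonneg _) (hnn j d)]
  refine Finset.sum_congr rfl fun j _ => ?_
  rw [lintegral_finsetSum _ fun d _ => measurable_const.indicator (hset j d),
    ENNReal.ofReal_sum_of_nonneg fun d _ => mul_nonneg (Nat.cast_nonneg _) (hnn j d)]
  refine Finset.sum_congr rfl fun d _ => ?_
  rw [lintegral_indicator_const (hset j d), hX.law, ENNReal.ofReal_mul (Nat.cast_nonneg _),
    ENNReal.ofReal_natCast]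

end Freeway

/-! ### Measurability and independence of functions of past arrivals. -/

section History

variable {m : ℕ} {Ω : Type*} [MeasurableSpace Ω] {P : Measure Ω} {lam : Fin m → ℝ}
  {R : Matrix (Fin m) (Fin m) ℝ} {X : ℕ → Fin m → Ω → Bool × Fin m}

/-- The arrivals up to time `t`, followed by no arrivals. -/
def padHistory (t : ℕ)
    (x : (Finset.range t ×ˢ (Finset.univ : Finset (Fin m)) : Finset (ℕ × Fin m)) → Bool × Fin m) :
    ℕ → Fin m → Bool × Fin m :=
  fun s j => if h : s < t then x ⟨(s, j), by simpa using h⟩ else (false, j)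

/-- `φ` depends only on the arrivals before time `t`. -/
def DependsOnPast {E : Type*} (t : ℕ) (φ : (ℕ → Fin m → Bool × Fin m) → E) : Prop :=
  ∀ x y, (∀ s < t, x s = y s) → φ x = φ y

theorem DependsOnPast.eq_padHistory {E : Type*} {t : ℕ} {φ : (ℕ → Fin m → Bool × Fin m) → E}
    (h : DependsOnPast t φ) (x : ℕ → Fin m → Bool × Fin m) :
    φ x = φ (padHistory t fun p => x p.1.1 p.1.2) := by
  refine h _ _ fun s hs => ?_
  funext j
  simp [padHistory, hs]

/-- Such a function factors through finitely many marks in a finite space, on which every map is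
measurable and takes finitely many values. -/
theorem DependsOnPast.measurable {E : Type*} [MeasurableSpace E] {t : ℕ}
    {φ : (ℕ → Fin m → Bool × Fin m) → E} (h : DependsOnPast t φ) (hX : IsDemand P lam R X) :
    Measurable fun ω => φ fun s j => X s j ω := by
  have h1 : (fun ω => φ fun s j => X s j ω) =
      (fun x => φ (padHistory t x)) ∘ fun ω p => X p.1.1 p.1.2 ω := by
    funext ω
    exact h.eq_padHistory _
  rw [h1]
  exact (measurable_of_finite _).comp (measurable_pi_lambda _ fun p => hX.measurable _ _)

theorem DependsOnPast.bounded {t : ℕ} {φ : (ℕ → Fin m → Bool × Fin m) → ℝ}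
    (h : DependsOnPast t φ) : ∃ B, ∀ x, φ x ≤ B := by
  obtain ⟨B, hB⟩ := (Set.finite_range fun x => φ (padHistory t x)).bddAbove
  exact ⟨B, fun x => by rw [h.eq_padHistory x]; exact hB ⟨_, rfl⟩⟩

theorem measurable_arrivals {E : Type*} [MeasurableSpace E] (hX : IsDemand P lam R X) (t : ℕ)
    (ψ : (Fin m → Bool × Fin m) → E) : Measurable fun ω => ψ fun j => X t j ω :=
  (measurable_of_finite ψ).comp (measurable_pi_lambda _ fun j => hX.measurable t j)

theorem DependsOnPast.indepFun {E E' : Type*} [MeasurableSpace E] [MeasurableSpace E'] {t : ℕ}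
    {φ : (ℕ → Fin m → Bool × Fin m) → E} (h : DependsOnPast t φ) (hX : IsDemand P lam R X)
    (ψ : (Fin m → Bool × Fin m) → E') :
    IndepFun (fun ω => φ fun s j => X s j ω) (fun ω => ψ fun j => X t j ω) P := by
  have hdisj : Disjoint (Finset.range t ×ˢ (Finset.univ : Finset (Fin m)))
      ({t} ×ˢ (Finset.univ : Finset (Fin m))) := by
    rw [Finset.disjoint_left]
    rintro ⟨s, j⟩ h1 h2
    simp at h1 h2
    omega
  have key := hX.indep.indepFun_finset _ _ hdisj fun p => hX.measurable p.1 p.2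
  have := key.comp (φ := fun x => φ (padHistory t x))
    (ψ := fun x => ψ fun j => x ⟨(t, j), by simp⟩) (measurable_of_finite _) (measurable_of_finite _)
  have h1 : (fun ω => φ fun s j => X s j ω) =
      (fun x => φ (padHistory t x)) ∘ fun ω p => X p.1.1 p.1.2 ω := by
    funext ω
    exact h.eq_padHistory _
  rw [h1]
  exact this

end History

/-! ### Geometric drift and boundedness of the expected queues. -/

theorem exists_exponents {m : ℕ} [NeZero m] (r : Fin m → ℝ) (hr : ∀ i, r i < 1) {M : ℝ}
    (hM : 0 ≤ M) : ∃ α θ β : ℝ, 0 < α ∧ α < θ ∧ 0 < β ∧ β < 1 ∧ θ * M ≤ 1 ∧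
      ∀ i, Real.exp (-α) * (1 + θ * r i + (θ * M) ^ 2) ≤ β := by
  obtain ⟨i₀, hi₀⟩ := Finite.exists_max r
  obtain ⟨s, hs0, hs1, hs⟩ : ∃ s, 0 ≤ s ∧ s < 1 ∧ ∀ i, r i ≤ s :=
    ⟨max (r i₀) 0, le_max_right _ _, max_lt (hr i₀) one_pos, fun i => (hi₀ i).trans (le_max_left _ _)⟩
  have hD : 0 < 2 * (M ^ 2 + M + 1) := by positivity
  -- This `θ` gives `θ * M ≤ 1` and `θ * M ^ 2 ≤ (1 - s) / 2`, so the quadratic term raises the rate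
  -- from `s` to at most `(1 + s) / 2`. Then `α / θ = (3 + s) / 4` is the midpoint between that rate
  -- and 1.
  set θ := (1 - s) / (2 * (M ^ 2 + M + 1)) with hθ
  have hθ0 : 0 < θ := div_pos (by linarith) hD
  have hθD : θ * (2 * (M ^ 2 + M + 1)) = 1 - s := div_mul_cancel₀ _ hD.ne'
  have hθM : 0 ≤ θ * M := by positivity
  have hθM2 : 0 ≤ θ * M ^ 2 := by positivity
  refine ⟨θ * (3 + s) / 4, θ, Real.exp (-(θ * (1 - s) / 4)), by positivity, by nlinarith,
    Real.exp_pos _, (Real.exp_lt_exp.2 ?_).trans_eq Real.exp_zero, by nlinarith, fun i => ?_⟩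
  · have : 0 < θ * (1 - s) := mul_pos hθ0 (by linarith)
    linarith
  · have h1 : 1 + θ * r i + (θ * M) ^ 2 ≤ Real.exp (θ * ((1 + s) / 2)) := by
      refine le_trans ?_ (Real.add_one_le_exp _)
      have h2 : θ * r i ≤ θ * s := mul_le_mul_of_nonneg_left (hs i) hθ0.le
      have h3 : θ * M ^ 2 ≤ (1 - s) / 2 := by nlinarith
      have h4 : θ * (θ * M ^ 2) ≤ θ * ((1 - s) / 2) := mul_le_mul_of_nonneg_left h3 hθ0.le
      nlinarith
    calc _ ≤ Real.exp (-(θ * (3 + s) / 4)) * Real.exp (θ * ((1 + s) / 2)) := by gcongr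
      _ = _ := by rw [← Real.exp_add]; ring_nf

namespace Freeway

variable {m : ℕ}

/-- Since `exp y ≤ 1 + y + y ^ 2` for `0 ≤ y ≤ 1`, and the square is bounded by its maximum, only
the mean of the arriving work enters. -/
theorem lintegral_exp_arrivalWork_le (F : Freeway m) {lam : Fin m → ℝ}
    {R : Matrix (Fin m) (Fin m) ℝ} (hlam : IsRate lam) (hR : IsRouting R) {Ω : Type*}
    [MeasurableSpace Ω] {P : Measure Ω} [IsProbabilityMeasure P]
    {X : ℕ → Fin m → Ω → Bool × Fin m} (hX : IsDemand P lam R X) (t : ℕ) (i : Fin m) {α θ : ℝ}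
    (hθ : 0 ≤ θ) (hθM : θ * F.maxArrivalWork ≤ 1) :
    ∫⁻ ω, ENNReal.ofReal (Real.exp (θ * F.arrivalWork i (fun j => X t j ω) - α)) ∂P ≤
      ENNReal.ofReal
        (Real.exp (-α) * (1 + θ * F.meanWork lam R i + (θ * F.maxArrivalWork) ^ 2)) := by
  have hm0 : 0 ≤ F.meanWork lam R i := Finset.sum_nonneg fun j _ => Finset.sum_nonneg fun d _ =>
    mul_nonneg (Nat.cast_nonneg _) (mul_nonneg (hlam j).1 (hR.1 j d))
  have hpt : ∀ x : Fin m → Bool × Fin m,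
      ENNReal.ofReal (Real.exp (θ * F.arrivalWork i x - α)) ≤
        ENNReal.ofReal (Real.exp (-α) * (1 + (θ * F.maxArrivalWork) ^ 2)) +
          ENNReal.ofReal (Real.exp (-α) * θ) * (F.arrivalWork i x : ENNReal) := by
    intro x
    rw [← ENNReal.ofReal_natCast (F.arrivalWork i x), ← ENNReal.ofReal_mul (by positivity),
      ← ENNReal.ofReal_add (by positivity) (by positivity)]
    refine ENNReal.ofReal_le_ofReal ?_
    have h1 : (F.arrivalWork i x : ℝ) ≤ F.maxArrivalWork := by
      exact_mod_cast F.arrivalWork_le i x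
    have h2 : θ * F.arrivalWork i x ≤ θ * F.maxArrivalWork := by gcongr
    have h0 : 0 ≤ θ * F.arrivalWork i x := by positivity
    have h3 := (abs_le.1 (Real.abs_exp_sub_one_sub_id_le (x := θ * F.arrivalWork i x)
      (by rw [abs_of_nonneg h0]; linarith))).2
    have h4 : (θ * F.arrivalWork i x) ^ 2 ≤ (θ * F.maxArrivalWork) ^ 2 := by gcongr
    calc Real.exp (θ * F.arrivalWork i x - α)
        = Real.exp (-α) * Real.exp (θ * F.arrivalWork i x) := by rw [← Real.exp_add]; ring_nf
      _ ≤ Real.exp (-α) * (1 + (θ * F.maxArrivalWork) ^ 2 + θ * F.arrivalWork i x) := by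
          gcongr
          linarith
      _ = _ := by ring
  refine (lintegral_mono fun ω => hpt fun j => X t j ω).trans ?_
  rw [lintegral_add_left measurable_const, lintegral_const, measure_univ, mul_one,
    lintegral_const_mul _ (measurable_arrivals hX t fun x => (F.arrivalWork i x : ENNReal)),
    F.lintegral_arrivalWork hlam hR hX, ← ENNReal.ofReal_mul (by positivity),
    ← ENNReal.ofReal_add (by positivity) (by positivity)]
  refine ENNReal.ofReal_le_ofReal (le_of_eq ?_)
  ring

/-- The state at time `t` is a function of earlier arrivals, hence independent of those in step `t`;
the expectation of each product factorizes and its second factor is at most `β`. -/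
theorem lintegral_lyapunov_succ_le [NeZero m] (F : Freeway m) {lam : Fin m → ℝ}
    {R : Matrix (Fin m) (Fin m) ℝ} (hlam : IsRate lam) (hR : IsRouting R) {Ω : Type*}
    [MeasurableSpace Ω] {P : Measure Ω} [IsProbabilityMeasure P]
    {X : ℕ → Fin m → Ω → Bool × Fin m} (hX : IsDemand P lam R X) {α θ β ε K : ℝ}
    (hθ : 0 ≤ θ) (hε : 0 ≤ ε) (hβ : 0 ≤ β) (hθM : θ * F.maxArrivalWork ≤ 1)
    (hβm : ∀ i, Real.exp (-α) * (1 + θ * F.meanWork lam R i + (θ * F.maxArrivalWork) ^ 2) ≤ β)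
    (rule : CycleEnd) (T0 : ℕ) (q0 : Fin m → List (Fin m)) (res0 : List (Vehicle m F.nc))
    (hK0 : 0 ≤ K)
    (hK : ∀ (S : State m F.nc) (x : Fin m → Bool × Fin m),
      F.Admissible res0.length S → F.lyapunov α θ (F.renewalStep rule S x) ≤
        (∑ i, Real.exp (α * F.remaining S + θ * F.arrivedWork i S) *
          Real.exp (θ * F.arrivalWork i x - α)) + ε * F.lyapunov α θ S + K)
    {t : ℕ} (ht : T0 ≤ t) :
    ∫⁻ ω, ENNReal.ofReal (F.lyapunov α θ
        (F.renewalState rule T0 q0 res0 (fun s j => X s j ω) (t + 1))) ∂P ≤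
      ENNReal.ofReal (β + ε) * ∫⁻ ω, ENNReal.ofReal (F.lyapunov α θ
        (F.renewalState rule T0 q0 res0 (fun s j => X s j ω) t)) ∂P + ENNReal.ofReal K := by
  set st : (ℕ → Fin m → Bool × Fin m) → State m F.nc :=
    fun x => F.renewalState rule T0 q0 res0 x t with hst
  have hpast : ∀ {E : Type} (f : State m F.nc → E), DependsOnPast t fun x => f (st x) :=
    fun f x y h => congrArg f (F.renewalState_congr rule T0 q0 res0 t h)
  set f : Fin m → State m F.nc → ENNReal := fun i S =>
    ENNReal.ofReal (Real.exp (α * F.remaining S + θ * F.arrivedWork i S)) with hf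
  set k : Fin m → (Fin m → Bool × Fin m) → ENNReal := fun i x =>
    ENNReal.ofReal (Real.exp (θ * F.arrivalWork i x - α)) with hk
  have hsumf : ∀ S, ENNReal.ofReal (F.lyapunov α θ S) = ∑ i, f i S := fun S =>
    ENNReal.ofReal_sum_of_nonneg fun i _ => (Real.exp_pos _).le
  have hfm : ∀ i, Measurable fun ω => f i (st fun s j => X s j ω) := fun i =>
    (hpast (f i)).measurable hX
  have hkm : ∀ i, Measurable fun ω => k i fun j => X t j ω := fun i =>
    measurable_arrivals hX t (k i)
  have hLm : Measurable fun ω => ENNReal.ofReal (F.lyapunov α θ (st fun s j => X s j ω)) :=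
    (hpast fun S => ENNReal.ofReal (F.lyapunov α θ S)).measurable hX
  have hstep : ∀ x : ℕ → Fin m → Bool × Fin m,
      ENNReal.ofReal (F.lyapunov α θ (F.renewalState rule T0 q0 res0 x (t + 1))) ≤
        (∑ i, f i (st x) * k i (x t)) + ENNReal.ofReal ε * ENNReal.ofReal (F.lyapunov α θ (st x))
          + ENNReal.ofReal K := by
    intro x
    have h1 : F.renewalState rule T0 q0 res0 x (t + 1) = F.renewalStep rule (st x) (x t) := by
      rw [renewalState, if_neg (by omega)]
    have h2 := hK (st x) (x t) (F.admissible_renewalState rule T0 q0 res0 x t)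
    rw [h1]
    refine (ENNReal.ofReal_le_ofReal h2).trans (le_of_eq ?_)
    have h3 := F.lyapunov_nonneg α θ (st x)
    have h4 : 0 ≤ ∑ i, Real.exp (α * F.remaining (st x) + θ * F.arrivedWork i (st x)) *
        Real.exp (θ * F.arrivalWork i (x t) - α) := Finset.sum_nonneg fun _ _ => by positivity
    rw [ENNReal.ofReal_add (by positivity) hK0, ENNReal.ofReal_add h4 (by positivity),
      ENNReal.ofReal_mul hε, ENNReal.ofReal_sum_of_nonneg fun _ _ => by positivity]
    congr 2
    refine Finset.sum_congr rfl fun i _ => ?_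
    rw [ENNReal.ofReal_mul (Real.exp_pos _).le]
  refine (lintegral_mono fun ω => hstep fun s j => X s j ω).trans ?_
  rw [lintegral_add_right _ measurable_const, lintegral_const, measure_univ, mul_one,
    lintegral_add_right _ (hLm.const_mul _), lintegral_const_mul _ hLm,
    lintegral_finsetSum (f := fun i ω => f i (st fun s j => X s j ω) * k i fun j => X t j ω) _
      fun i _ => (hfm i).mul (hkm i), ENNReal.ofReal_add hβ hε, add_mul]
  gcongr
  calc ∑ i, ∫⁻ ω, f i (st fun s j => X s j ω) * k i (fun j => X t j ω) ∂P
      = ∑ i, (∫⁻ ω, f i (st fun s j => X s j ω) ∂P) * ∫⁻ ω, k i (fun j => X t j ω) ∂P :=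
        Finset.sum_congr rfl fun i _ => lintegral_mul_eq_lintegral_mul_lintegral_of_indepFun
          (hfm i) (hkm i) ((hpast (f i)).indepFun hX (k i))
    _ ≤ ∑ i, (∫⁻ ω, f i (st fun s j => X s j ω) ∂P) * ENNReal.ofReal β := by
        gcongr with i
        exact (F.lintegral_exp_arrivalWork_le hlam hR hX t i hθ hθM).trans
          (ENNReal.ofReal_le_ofReal (hβm i))
    _ = ENNReal.ofReal β * ∫⁻ ω, ENNReal.ofReal (F.lyapunov α θ (st fun s j => X s j ω)) ∂P := by
        simp only [hsumf]
        rw [lintegral_finsetSum _ fun i _ => hfm i, ← Finset.sum_mul, mul_comm]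

theorem underSaturated_renewal [NeZero m] (F : Freeway m) {lam : Fin m → ℝ}
    {R : Matrix (Fin m) (Fin m) ℝ} (hR : IsRouting R) (hlam : lam ∈ renewalEstimate F R)
    {Ω : Type*} [MeasurableSpace Ω] (P : Measure Ω) [IsProbabilityMeasure P]
    {X : ℕ → Fin m → Ω → Bool × Fin m} (hX : IsDemand P lam R X) (rule : CycleEnd) (T0 : ℕ)
    (q0 : Fin m → List (Fin m)) (res0 : List (Vehicle m F.nc)) :
    UnderSaturated P fun i t ω =>
      ((F.renewalState rule T0 q0 res0 (fun s j => X s j ω) t).queue i).length := by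
  obtain ⟨hrate, hcond⟩ := hlam
  obtain ⟨α, θ, β, hα, hαθ, hβ0, hβ1, hθM, hβm⟩ := exists_exponents (F.meanWork lam R)
    (fun i => by rw [F.meanWork_eq lam hR i]; exact hcond i) (M := F.maxArrivalWork)
    (Nat.cast_nonneg _)
  have hε : 0 < (1 - β) / 2 := by linarith
  obtain ⟨K, hK0, hK⟩ := F.exists_lyapunov_step res0.length hα.le hαθ hε
  set a : ℕ → ENNReal := fun t => ∫⁻ ω, ENNReal.ofReal (F.lyapunov α θ
    (F.renewalState rule T0 q0 res0 (fun s j => X s j ω) t)) ∂P with ha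
  have hstep : ∀ t, T0 ≤ t → a (t + 1) ≤ ENNReal.ofReal (β + (1 - β) / 2) * a t + ENNReal.ofReal K :=
    fun t ht => F.lintegral_lyapunov_succ_le hrate hR hX (hα.trans hαθ).le hε.le hβ0.le hθM hβm
      rule T0 q0 res0 hK0 (fun S x => hK rule S x) ht
  obtain ⟨B, hB⟩ := DependsOnPast.bounded (t := T0)
    (φ := fun x => F.lyapunov α θ (F.renewalState rule T0 q0 res0 x T0))
    fun x y h => congrArg (F.lyapunov α θ) (F.renewalState_congr rule T0 q0 res0 T0 h)
  -- The recursion has factor `β + ε = (1 + β) / 2` and fixed point `2 * K / (1 - β)`; any `C` above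
  -- both this and the value at `T0` is preserved.
  set C := max (max B 0) (2 * K / (1 - β)) with hC
  have hC0 : 0 ≤ C := (le_max_right _ _).trans (le_max_left _ _)
  have hCK : (β + (1 - β) / 2) * C + K ≤ C := by
    have h1 : 2 * K / (1 - β) ≤ C := le_max_right _ _
    rw [div_le_iff₀ (by linarith)] at h1
    linarith
  have hbound : ∀ t, T0 ≤ t → a t ≤ ENNReal.ofReal C := by
    intro t ht
    induction t, ht using Nat.le_induction with
    | base =>
      have hBC : B ≤ C := (le_max_left _ _).trans (le_max_left _ _)
      refine (lintegral_mono fun ω => ENNReal.ofReal_le_ofReal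
        ((hB fun s j => X s j ω).trans hBC)).trans ?_
      rw [lintegral_const, measure_univ, mul_one]
    | succ t ht ih =>
      calc a (t + 1) ≤ ENNReal.ofReal (β + (1 - β) / 2) * ENNReal.ofReal C + ENNReal.ofReal K :=
            (hstep t ht).trans (by gcongr)
        _ = ENNReal.ofReal ((β + (1 - β) / 2) * C + K) := by
            rw [← ENNReal.ofReal_mul (by linarith),
              ← ENNReal.ofReal_add (mul_nonneg (by linarith) hC0) hK0]
        _ ≤ _ := ENNReal.ofReal_le_ofReal hCK
  intro i
  refine lt_of_le_of_lt (limsup_le_of_le (a := ENNReal.ofReal α⁻¹ * ENNReal.ofReal C)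
    (h := ?_)) (ENNReal.mul_lt_top ENNReal.ofReal_lt_top ENNReal.ofReal_lt_top)
  filter_upwards [eventually_ge_atTop T0] with t ht
  calc _ ≤ ∫⁻ ω, ENNReal.ofReal α⁻¹ * ENNReal.ofReal (F.lyapunov α θ
        (F.renewalState rule T0 q0 res0 (fun s j => X s j ω) t)) ∂P := by
        refine lintegral_mono fun ω => ?_
        rw [← ENNReal.ofReal_mul (by positivity), ← ENNReal.ofReal_natCast]
        exact ENNReal.ofReal_le_ofReal ((F.admissible_renewalState rule T0 q0 res0 _
          t).length_queue_le_lyapunov hα hαθ i)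
    _ = ENNReal.ofReal α⁻¹ * a t := lintegral_const_mul' _ _ ENNReal.ofReal_ne_top
    _ ≤ _ := by gcongr; exact hbound t ht

theorem drrEstimate_subset_renewalEstimate (F : Freeway m) (R : Matrix (Fin m) (Fin m) ℝ) :
    drrEstimate F R ⊆ renewalEstimate F R := by
  rintro lam ⟨h1, h2⟩
  refine ⟨h1, fun i => lt_of_le_of_lt (sub_le_self _ (mul_nonneg ?_ (h1 i).1)) (h2 i)⟩
  rw [OnRamp.tauMerge_div_tau, sub_nonneg]
  exact_mod_cast (F.ramp i).two_le_headwaySteps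

end Freeway

end RampMetering

end

theorem mainTheorem2 {m : ℕ} [NeZero m] (F : RampMetering.Freeway m)
    (R : Matrix (Fin m) (Fin m) ℝ) (hR : RampMetering.IsRouting R) :
    (∀ lam ∈ RampMetering.renewalEstimate F R,
      ∀ {Ω : Type*} [MeasurableSpace Ω] (P : MeasureTheory.Measure Ω)
        [MeasureTheory.IsProbabilityMeasure P] (X : ℕ → Fin m → Ω → Bool × Fin m),
        RampMetering.IsDemand P lam R X →
        ∀ (rule : RampMetering.CycleEnd) (T0 : ℕ) (q0 : Fin m → List (Fin m))
          (res0 : List (RampMetering.Vehicle m F.nc)),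
          RampMetering.UnderSaturated P fun i t ω =>
            ((F.renewalState rule T0 q0 res0 (fun s j => X s j ω) t).queue i).length) ∧
    RampMetering.drrEstimate F R ⊆ RampMetering.renewalEstimate F R := by
  exact ⟨fun lam hlam _ _ P _ X hX rule T0 q0 res0 =>
    F.underSaturated_renewal hR hlam P hX rule T0 q0 res0,
    F.drrEstimate_subset_renewalEstimate R⟩
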